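/- A plane quartic is a curve $Q=\{F=0\}\subset\mathbb P^2=\mathbb P^2(\mathbb C)$ with $F\in\mathbb C[x,y,z]$ nonzero and homogeneous of degree $4$, taken up to a nonzero scalar. A node is a double point with two distinct tangent lines; an ordinary cusp is a double point with a single (double) tangent line, which meets $Q$ there with multiplicity exactly $3$; a flex point is a smooth point of $Q$ whose tangent line meets $Q$ there with multiplicity at least $3$. Theorem. Up to projective equivalence there is a unique plane quartic $Q$ that contains distinct points $p_1,\dots,p_7$ such that: (1) $Q$ has a node at $p_1$ and ordinary cusps at $p_2$ and $p_3$; (2) $p_4$ and $p_5$ are flex points of $Q$; (3) the tangent lines to $Q$ at $p_4$ and $p_5$ contain $p_6$ and $p_7$, respectively; (4) the line through $p_6$ and $p_7$ contains $p_1$. More precisely, for every such $(Q;p_1,\dots,p_7)$ there is a projective transformation of $\mathbb P^2$ after which $$p_1=[0:0:1],\quad p_2=[0:1:1],\quad p_3=[1:0:1],$$ $Q$ has the equation $$(x^2+xy+y^2-xz-yz)^2-8xy(x+y-z)^2=0,$$ and, for one of the two square roots $r$ of $-2$, $$p_4=[8+2r:8-2r:25],\quad p_5=[8-2r:8+2r:25],\quad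 p_6=[-2r:2r:1],\quad p_7=[2r:-2r:1].$$ Conversely, for either square root $r$ of $-2$, this curve with these seven points satisfies (1)–(4). -/

import Mathlib

open scoped LinearAlgebra.Projectivization

noncomputable section

namespace PlaneQuartic

/-- The complex projective plane. -/
abbrev Plane : Type := ℙ ℂ (Fin 3 → ℂ)

/-- Polynomials in the homogeneous coordinates `x = X 0`, `y = X 1`, `z = X 2`. -/
abbrev Form : Type := MvPolynomial (Fin 3) ℂ

/-- `F` is an equation of a plane quartic curve. The curve is `F` up to a nonzero scalar.
All the predicates below, for such an `F`, depend neither on this scalar nor on the chosen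
representative vectors of the points. -/
def IsQuartic (F : Form) : Prop := F ≠ 0 ∧ F.IsHomogeneous 4

/-- The point `p` lies on the curve `F = 0`. -/
def OnCurve (F : Form) (p : Plane) : Prop := MvPolynomial.eval p.rep F = 0

/-- The value at `p` of the partial derivative of `F` with respect to the `i`-th coordinate. -/
def partialAt (F : Form) (p : Plane) (i : Fin 3) : ℂ :=
  MvPolynomial.eval p.rep (MvPolynomial.pderiv i F)

/-- `p` is a smooth point of the curve `F = 0`. -/
def IsSmoothPoint (F : Form) (p : Plane) : Prop :=
  OnCurve F p ∧ ∃ i, partialAt F p i ≠ 0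

/-- `p` is a singular point of the curve `F = 0`. -/
def IsSingularPoint (F : Form) (p : Plane) : Prop :=
  OnCurve F p ∧ ∀ i, partialAt F p i = 0

/-- `q` lies on the tangent line to `F = 0` at `p` (meaningful if `p` is a smooth point). -/
def OnTangentLine (F : Form) (p q : Plane) : Prop :=
  ∑ i, partialAt F p i * q.rep i = 0

/-- The intersection multiplicity at `p` of the curve `F = 0` with the line through the distinct
points `p` and `q`: the order of vanishing at `t = 0` of `F (p + t q)`. It is `⊤` if the line is
contained in the curve. -/
def lineMult (F : Form) (p q : Plane) : ℕ∞ :=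
  emultiplicity (Polynomial.X : Polynomial ℂ)
    (MvPolynomial.aeval
      (fun i => Polynomial.C (p.rep i) + Polynomial.X * Polynomial.C (q.rep i)) F)

/-- The quadratic form `w ↦ ∑ ∂ᵢ∂ⱼF(p) wᵢ wⱼ`. At a singular point `p` of `F = 0` it is, up to
the factor `2`, the degree two part of the Taylor expansion of `F` at `p`; at a double point
its zero locus is the tangent cone. -/
def quadraticPart (F : Form) (p : Plane) (w : Fin 3 → ℂ) : ℂ :=
  ∑ i, ∑ j,
    MvPolynomial.eval p.rep (MvPolynomial.pderiv i (MvPolynomial.pderiv j F)) * w i * w j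

/-- A node (ordinary double point): a double point whose tangent cone consists of two distinct
lines. -/
def IsNode (F : Form) (p : Plane) : Prop :=
  IsSingularPoint F p ∧
    ∃ l m : Module.Dual ℂ (Fin 3 → ℂ), LinearIndependent ℂ ![l, m] ∧
      ∀ w, quadraticPart F p w = l w * m w

/-- An ordinary cusp: a double point whose tangent cone is a double line, this line meeting the
curve at the point with intersection multiplicity exactly three. -/
def IsOrdinaryCusp (F : Form) (p : Plane) : Prop :=
  IsSingularPoint F p ∧
    ∃ l : Module.Dual ℂ (Fin 3 → ℂ), l ≠ 0 ∧
      (∀ w, quadraticPart F p w = l w ^ 2) ∧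
      ∀ q : Plane, q ≠ p → l q.rep = 0 → lineMult F p q = 3

/-- A flex point: a smooth point at which the tangent line meets the curve with intersection
multiplicity at least three. -/
def IsFlex (F : Form) (p : Plane) : Prop :=
  IsSmoothPoint F p ∧ ∀ q : Plane, q ≠ p → OnTangentLine F p q → 3 ≤ lineMult F p q

/-- The quartic `F = 0` with the points `p₁, …, p₇` (here `p 0, …, p 6`): a node `p₁`, ordinary
cusps `p₂, p₃`, flex points `p₄, p₅`, and points `p₆, p₇` of the curve on the tangent lines at
`p₄, p₅` such that `p₁, p₆, p₇` are collinear. -/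
structure IsConfiguration (F : Form) (p : Fin 7 → Plane) : Prop where
  quartic : IsQuartic F
  distinct : Function.Injective p
  node : IsNode F (p 0)
  cusp₂ : IsOrdinaryCusp F (p 1)
  cusp₃ : IsOrdinaryCusp F (p 2)
  flex₄ : IsFlex F (p 3)
  flex₅ : IsFlex F (p 4)
  mem₆ : OnCurve F (p 5)
  mem₇ : OnCurve F (p 6)
  tangent₄ : OnTangentLine F (p 3) (p 5)
  tangent₅ : OnTangentLine F (p 4) (p 6)
  collinear : Projectivization.Dependent ![p 0, p 5, p 6]

/-- The projective transformation given by `T` maps the curve `F = 0` onto the curve `G = 0`: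
`G ∘ T` and `F` agree up to a nonzero scalar. -/
def MapsCurve (T : (Fin 3 → ℂ) ≃ₗ[ℂ] (Fin 3 → ℂ)) (F G : Form) : Prop :=
  ∃ c : ℂ, c ≠ 0 ∧
    MvPolynomial.bind₁ (LinearMap.toMatrix' T.toLinearMap).toMvPolynomial G = c • F

/-- Projective equivalence of plane curves. -/
def ProjectivelyEquivalent (F G : Form) : Prop :=
  ∃ T : (Fin 3 → ℂ) ≃ₗ[ℂ] (Fin 3 → ℂ), MapsCurve T F G

/-- The form `(x² + xy + y² - xz - yz)² - 8xy(x + y - z)²`. -/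
def stdQuartic : Form :=
  let x : Form := MvPolynomial.X 0
  let y : Form := MvPolynomial.X 1
  let z : Form := MvPolynomial.X 2
  (x ^ 2 + x * y + y ^ 2 - x * z - y * z) ^ 2 - 8 * x * y * (x + y - z) ^ 2

/-- Homogeneous coordinates of the seven points; `r` is a square root of `-2`. -/
def stdCoords (r : ℂ) : Fin 7 → Fin 3 → ℂ :=
  ![![0, 0, 1],
    ![0, 1, 1],
    ![1, 0, 1],
    ![8 + 2 * r, 8 - 2 * r, 25],
    ![8 - 2 * r, 8 + 2 * r, 25],
    ![-2 * r, 2 * r, 1],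
    ![2 * r, -2 * r, 1]]

theorem stdCoords_ne_zero (r : ℂ) (i : Fin 7) : stdCoords r i ≠ 0 := by
  intro h
  have h2 := congrFun h 2
  fin_cases i <;> simp [stdCoords] at h2

/-- The seven points with coordinates `stdCoords r`. -/
def stdPoints (r : ℂ) (i : Fin 7) : Plane :=
  Projectivization.mk ℂ (stdCoords r i) (stdCoords_ne_zero r i)

end PlaneQuartic

end

/-! Place the cusps `p 2`, `p 1` and the node `p 0` at the coordinate vertices. They are not
collinear: by intersection multiplicity, the line joining the two cusps meets the quartic nowhere
else. Double points at the vertices leave six monomials. The cusp conditions make two quadratic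
parts squares, and rescaling gives (xy+xz+yz)² = k·xyz²; the node condition becomes k ≠ 0, 4
(`exists_normalForm`).

With k = κ², the standard Cremona involution turns this curve into the conic (X+Y+Z)² = κ²XY, so the
curve is rational with a parameter m satisfying y/x = m² (`param`). All conditions become algebra in
m. A flex satisfies 3κm² − (8+κ²)m + 3κ = 0 (`FlexAt.quadratic`). Its tangent meets the curve again
at n = κ − 3m (`residual_param`). Two curve points are collinear with the node only if m² = n²
(`sq_eq_sq_of_not_linearIndependent`).

For distinct flex parameters m₁, m₂, collinearity thus gives κ − 3m₁ = −(κ − 3m₂). Together with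
Vieta, 2κ = 3(m₁+m₂) = (8+κ²)/κ, so κ² = 8 and everything is determined up to the choice of r
(`flex_parameters`). The converse is checked on the normal form with k = 8. -/

noncomputable section

namespace PlaneQuartic

/-! ### Taylor coefficients of a form along a line -/

/-- The restriction `F (v + t w)` of the form `F` to the line through `v` in direction `w`. -/
def along (F : Form) (v w : Fin 3 → ℂ) : Polynomial ℂ :=
  MvPolynomial.aeval (fun i => Polynomial.C (v i) + Polynomial.X * Polynomial.C (w i)) F

theorem eval_along (F : Form) (v w : Fin 3 → ℂ) (t : ℂ) :
    (along F v w).eval t = MvPolynomial.eval (v + t • w) F := by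
  induction F using MvPolynomial.induction_on with
  | C a => simp [along]
  | add p q hp hq => simp only [along, map_add, Polynomial.eval_add] at *; rw [hp, hq]
  | mul_X p i hp =>
    simp only [along, map_mul, Polynomial.eval_mul] at *
    rw [hp]
    simp [mul_comm (w i)]

/-- Chain rule; applied once and twice, it identifies the coefficients of orders one and two with
partial derivatives. -/
theorem derivative_along (F : Form) (v w : Fin 3 → ℂ) :
    Polynomial.derivative (along F v w) =
      ∑ i, Polynomial.C (w i) * along (MvPolynomial.pderiv i F) v w := by
  induction F using MvPolynomial.induction_on with
  | C a => simp [along]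
  | add p q hp hq =>
    simp only [along, map_add, mul_add, Finset.sum_add_distrib] at *
    rw [hp, hq]
  | mul_X p i hp =>
    have h : ∀ j, along (MvPolynomial.pderiv j (p * MvPolynomial.X i)) v w =
        along p v w * Polynomial.C (if j = i then 1 else 0) +
          along (MvPolynomial.X i) v w * along (MvPolynomial.pderiv j p) v w := by
      intro j
      simp only [along, Derivation.leibniz, smul_eq_mul, map_add, map_mul, MvPolynomial.pderiv_X,
        Pi.single_apply, eq_comm (a := i)]
      split_ifs <;> simp
    have h' : along (p * MvPolynomial.X i) v w = along p v w * along (MvPolynomial.X i) v w :=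
      map_mul _ _ _
    have hX : Polynomial.derivative (along (MvPolynomial.X i) v w) = Polynomial.C (w i) := by
      simp [along]
    simp only [h, h', Polynomial.derivative_mul, hX, hp, mul_add, Finset.sum_add_distrib,
      Finset.sum_mul]
    rw [add_comm]
    refine congrArg₂ (· + ·) ?_ (Finset.sum_congr rfl fun j _ => by ring)
    rw [Finset.sum_eq_single i (fun j _ hj => by simp [hj]) (by simp), if_pos rfl, map_one,
      mul_one, mul_comm]

theorem coeff_zero_along (F : Form) (v w : Fin 3 → ℂ) :
    (along F v w).coeff 0 = MvPolynomial.eval v F := by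
  rw [Polynomial.coeff_zero_eq_eval_zero, eval_along]; simp

theorem coeff_one_along (F : Form) (v w : Fin 3 → ℂ) :
    (along F v w).coeff 1 = ∑ i, MvPolynomial.eval v (MvPolynomial.pderiv i F) * w i := by
  have h := Polynomial.coeff_derivative (along F v w) 0
  simp only [derivative_along, Polynomial.finsetSum_coeff, Polynomial.coeff_C_mul,
    coeff_zero_along] at h
  simp at h
  rw [← h]
  exact Finset.sum_congr rfl fun i _ => mul_comm _ _

theorem two_mul_coeff_two_along (F : Form) (v w : Fin 3 → ℂ) :
    2 * (along F v w).coeff 2 =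
      ∑ i, ∑ j, MvPolynomial.eval v (MvPolynomial.pderiv i (MvPolynomial.pderiv j F)) *
        w i * w j := by
  have h := Polynomial.coeff_derivative (along F v w) 1
  simp only [derivative_along, Polynomial.finsetSum_coeff, Polynomial.coeff_C_mul,
    coeff_one_along, Finset.mul_sum] at h
  rw [Finset.sum_comm, mul_comm]
  norm_num at h
  rw [← h]
  refine Finset.sum_congr rfl fun i _ => Finset.sum_congr rfl fun j _ => ?_
  ring

theorem eval_smul_of_isHomogeneous {F : Form} {n : ℕ} (hF : F.IsHomogeneous n) (a : ℂ)
    (v : Fin 3 → ℂ) :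
    MvPolynomial.eval (a • v) F = a ^ n * MvPolynomial.eval v F := by
  rw [MvPolynomial.eval_eq, MvPolynomial.eval_eq, Finset.mul_sum]
  refine Finset.sum_congr rfl fun d hd => ?_
  have h := hF.degree_eq_sum_deg_support hd
  simp only [Pi.smul_apply, smul_eq_mul, mul_pow, Finset.prod_mul_distrib,
    Finset.prod_pow_eq_pow_sum]
  rw [h]
  ring

/-- Homogeneity gives F(av + tbw) = a⁴F(v + (b/a)tw). Hence the vanishing of a coefficient does not
depend on representatives. -/
theorem coeff_along_smul {F : Form} (hF : F.IsHomogeneous 4) {a : ℂ} (ha : a ≠ 0) (b : ℂ)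
    (v w : Fin 3 → ℂ) (k : ℕ) :
    (along F (a • v) (b • w)).coeff k = a ^ 4 * (b / a) ^ k * (along F v w).coeff k := by
  have : along F (a • v) (b • w) =
      Polynomial.C (a ^ 4) * (along F v w).comp (Polynomial.C (b / a) * Polynomial.X) := by
    refine Polynomial.funext fun t => ?_
    simp only [eval_along, Polynomial.eval_mul, Polynomial.eval_comp, Polynomial.eval_C,
      Polynomial.eval_X, ← eval_smul_of_isHomogeneous hF]
    congr 2
    ext i
    simp
    field_simp
  rw [this, Polynomial.coeff_C_mul, Polynomial.comp_C_mul_X_coeff]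
  ring

theorem along_eq_of_eval {F : Form} {v w : Fin 3 → ℂ} (c : Polynomial ℂ)
    (h : ∀ t : ℂ, MvPolynomial.eval (v + t • w) F = c.eval t) : along F v w = c :=
  Polynomial.funext fun t => by rw [eval_along, h]

/-- The coefficients of the restriction of `F` to a line can be read off from its values. -/
theorem coeff_along_of_eval {F : Form} {v w : Fin 3 → ℂ} {c₀ c₁ c₂ c₃ c₄ : ℂ}
    (h : ∀ t : ℂ, MvPolynomial.eval (v + t • w) F =
      c₀ + c₁ * t + c₂ * t ^ 2 + c₃ * t ^ 3 + c₄ * t ^ 4) :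
    (along F v w).coeff 0 = c₀ ∧ (along F v w).coeff 1 = c₁ ∧ (along F v w).coeff 2 = c₂ ∧
      (along F v w).coeff 3 = c₃ := by
  rw [along_eq_of_eval (Polynomial.C c₀ + Polynomial.C c₁ * Polynomial.X +
    Polynomial.C c₂ * Polynomial.X ^ 2 + Polynomial.C c₃ * Polynomial.X ^ 3 +
    Polynomial.C c₄ * Polynomial.X ^ 4) (by simpa using h)]
  simp [Polynomial.coeff_X, Polynomial.coeff_C]

/-! ### Local conditions expressed on representative vectors -/

/-- `F` vanishes to second order at the vector `v`. -/
def SingularAt (F : Form) (v : Fin 3 → ℂ) : Prop :=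
  MvPolynomial.eval v F = 0 ∧ ∀ w, (along F v w).coeff 1 = 0

/-- `F` has a node at the vector `v`. -/
def NodeAt (F : Form) (v : Fin 3 → ℂ) : Prop :=
  SingularAt F v ∧ ∃ l m : Module.Dual ℂ (Fin 3 → ℂ), LinearIndependent ℂ ![l, m] ∧
    ∀ u, (along F v u).coeff 2 = l u * m u

/-- `F` has an ordinary cusp at the vector `v`. -/
def CuspAt (F : Form) (v : Fin 3 → ℂ) : Prop :=
  SingularAt F v ∧ ∃ l : Module.Dual ℂ (Fin 3 → ℂ), l ≠ 0 ∧
    (∀ u, (along F v u).coeff 2 = l u ^ 2) ∧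
    ∀ u, LinearIndependent ℂ ![v, u] → l u = 0 → (along F v u).coeff 3 ≠ 0

/-- `F` has a flex at the vector `v`. -/
def FlexAt (F : Form) (v : Fin 3 → ℂ) : Prop :=
  (MvPolynomial.eval v F = 0 ∧ ∃ u, (along F v u).coeff 1 ≠ 0) ∧
    ∀ u, LinearIndependent ℂ ![v, u] → (along F v u).coeff 1 = 0 → (along F v u).coeff 2 = 0

theorem partialAt_eq (F : Form) (p : Plane) (i : Fin 3) :
    partialAt F p i = (along F p.rep (Pi.single i 1)).coeff 1 := by
  simp [coeff_one_along, partialAt, Pi.single_apply]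

theorem onTangentLine_iff_rep (F : Form) (p q : Plane) :
    OnTangentLine F p q ↔ (along F p.rep q.rep).coeff 1 = 0 := by
  simp only [coeff_one_along, OnTangentLine, partialAt]

theorem forall_partialAt_iff (F : Form) (p : Plane) :
    (∀ i, partialAt F p i = 0) ↔ ∀ w, (along F p.rep w).coeff 1 = 0 := by
  constructor
  · intro h w
    rw [coeff_one_along]
    exact Finset.sum_eq_zero fun i _ => mul_eq_zero_of_left (h i) _
  · intro h i
    rw [partialAt_eq, h]

theorem three_le_lineMult_iff (F : Form) (p q : Plane) :
    3 ≤ lineMult F p q ↔ ∀ k < 3, (along F p.rep q.rep).coeff k = 0 := by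
  rw [← Polynomial.X_pow_dvd_iff, pow_dvd_iff_le_emultiplicity]
  rfl

theorem lineMult_eq_three_iff (F : Form) (p q : Plane) :
    lineMult F p q = 3 ↔
      (∀ k < 3, (along F p.rep q.rep).coeff k = 0) ∧ (along F p.rep q.rep).coeff 3 ≠ 0 := by
  have h := emultiplicity_eq_coe (a := (Polynomial.X : Polynomial ℂ))
    (b := along F p.rep q.rep) (n := 3)
  rw [Polynomial.X_pow_dvd_iff, Polynomial.X_pow_dvd_iff] at h
  refine Iff.trans h (and_congr_right fun h3 => not_congr ⟨fun h4 => h4 3 (by norm_num),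
    fun h4 k hk => ?_⟩)
  rcases Nat.lt_succ_iff_lt_or_eq.mp hk with hk | rfl
  exacts [h3 k hk, h4]

theorem exists_rep_mk {v : Fin 3 → ℂ} (hv : v ≠ 0) :
    ∃ a : ℂ, a ≠ 0 ∧ (Projectivization.mk ℂ v hv).rep = a • v := by
  obtain ⟨a, ha⟩ := Projectivization.exists_smul_eq_mk_rep ℂ v hv
  exact ⟨a, a.ne_zero, ha.symm⟩

theorem onCurve_mk_iff {F : Form} (hF : F.IsHomogeneous 4) {v : Fin 3 → ℂ} (hv : v ≠ 0) :
    OnCurve F (Projectivization.mk ℂ v hv) ↔ MvPolynomial.eval v F = 0 := by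
  obtain ⟨a, ha, h⟩ := exists_rep_mk hv
  rw [OnCurve, h, eval_smul_of_isHomogeneous hF]
  simp [ha]

theorem coeff_along_rep_mk {F : Form} (hF : F.IsHomogeneous 4) {v : Fin 3 → ℂ} (hv : v ≠ 0)
    (k : ℕ) :
    ∃ a : ℂ, a ≠ 0 ∧ ∀ u, (along F (Projectivization.mk ℂ v hv).rep u).coeff k =
      a * (along F v u).coeff k := by
  obtain ⟨a, ha, h⟩ := exists_rep_mk hv
  refine ⟨a ^ 4 * (1 / a) ^ k, by simp [ha], fun u => ?_⟩
  have := coeff_along_smul hF ha 1 v u k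
  rwa [one_smul, ← h] at this

theorem coeff_along_mk_iff {F : Form} (hF : F.IsHomogeneous 4) {v : Fin 3 → ℂ} (hv : v ≠ 0)
    (u : Fin 3 → ℂ) (k : ℕ) :
    (along F (Projectivization.mk ℂ v hv).rep u).coeff k = 0 ↔ (along F v u).coeff k = 0 := by
  obtain ⟨a, ha, h⟩ := coeff_along_rep_mk hF hv k
  rw [h]
  simp [ha]

theorem coeff_along_mk_mk_iff {F : Form} (hF : F.IsHomogeneous 4) {v w : Fin 3 → ℂ}
    (hv : v ≠ 0) (hw : w ≠ 0) (k : ℕ) :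
    (along F (Projectivization.mk ℂ v hv).rep (Projectivization.mk ℂ w hw).rep).coeff k = 0 ↔
      (along F v w).coeff k = 0 := by
  obtain ⟨a, ha, h⟩ := exists_rep_mk hv
  obtain ⟨b, hb, h'⟩ := exists_rep_mk hw
  rw [h, h', coeff_along_smul hF ha]
  simp [ha, hb]

theorem isSingularPoint_mk_iff {F : Form} (hF : F.IsHomogeneous 4) {v : Fin 3 → ℂ}
    (hv : v ≠ 0) :
    IsSingularPoint F (Projectivization.mk ℂ v hv) ↔ SingularAt F v := by
  rw [IsSingularPoint, onCurve_mk_iff hF, forall_partialAt_iff]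
  simp only [coeff_along_mk_iff hF, SingularAt]

theorem isSmoothPoint_mk_iff {F : Form} (hF : F.IsHomogeneous 4) {v : Fin 3 → ℂ} (hv : v ≠ 0) :
    IsSmoothPoint F (Projectivization.mk ℂ v hv) ↔
      MvPolynomial.eval v F = 0 ∧ ∃ u, (along F v u).coeff 1 ≠ 0 := by
  have h := not_congr (forall_partialAt_iff F (Projectivization.mk ℂ v hv))
  push Not at h
  rw [IsSmoothPoint, onCurve_mk_iff hF, h]
  simp only [ne_eq, coeff_along_mk_iff hF]

theorem onTangentLine_mk_iff {F : Form} (hF : F.IsHomogeneous 4) {v w : Fin 3 → ℂ}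
    (hv : v ≠ 0) (hw : w ≠ 0) :
    OnTangentLine F (Projectivization.mk ℂ v hv) (Projectivization.mk ℂ w hw) ↔
      (along F v w).coeff 1 = 0 := by
  rw [onTangentLine_iff_rep, coeff_along_mk_mk_iff hF]

/-- The factor is written as a square so that it can be absorbed into the linear forms of a node or
a cusp, each scaled by s. -/
theorem quadraticPart_mk {F : Form} (hF : F.IsHomogeneous 4) {v : Fin 3 → ℂ} (hv : v ≠ 0) :
    ∃ s : ℂ, s ≠ 0 ∧ ∀ u, quadraticPart F (Projectivization.mk ℂ v hv) u =
      s ^ 2 * (along F v u).coeff 2 := by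
  obtain ⟨a, ha, h⟩ := coeff_along_rep_mk hF hv 2
  obtain ⟨s, hs⟩ := IsAlgClosed.exists_pow_nat_eq (2 * a) (n := 2) (by norm_num)
  refine ⟨s, ?_, fun u => ?_⟩
  · rintro rfl
    simp [ha] at hs
  · rw [quadraticPart, ← two_mul_coeff_two_along, h, hs]
    ring

theorem mk_ne_mk_iff {v w : Fin 3 → ℂ} (hv : v ≠ 0) (hw : w ≠ 0) :
    Projectivization.mk ℂ v hv ≠ Projectivization.mk ℂ w hw ↔ LinearIndependent ℂ ![v, w] := by
  rw [← Projectivization.independent_mk_iff_LinearIndependent hv hw,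
    Projectivization.independent_pair_iff_ne]

theorem dependent_mk_iff {u v w : Fin 3 → ℂ} (hu : u ≠ 0) (hv : v ≠ 0) (hw : w ≠ 0) :
    Projectivization.Dependent ![Projectivization.mk ℂ u hu, Projectivization.mk ℂ v hv,
      Projectivization.mk ℂ w hw] ↔ ¬ LinearIndependent ℂ ![u, v, w] := by
  have h0 : ∀ i, ![u, v, w] i ≠ 0 := by
    intro i
    fin_cases i
    exacts [hu, hv, hw]
  have h : ![Projectivization.mk ℂ u hu, Projectivization.mk ℂ v hv, Projectivization.mk ℂ w hw] =
      fun i => Projectivization.mk ℂ (![u, v, w] i) (h0 i) := by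
    ext i
    fin_cases i <;> rfl
  rw [h]
  constructor
  · intro hd hi
    exact Projectivization.dependent_iff_not_independent.1 hd (.mk _ _ hi)
  · exact fun hd => .mk _ _ hd

theorem isNode_mk_iff {F : Form} (hF : F.IsHomogeneous 4) {v : Fin 3 → ℂ} (hv : v ≠ 0) :
    IsNode F (Projectivization.mk ℂ v hv) ↔ NodeAt F v := by
  rw [IsNode, NodeAt, isSingularPoint_mk_iff hF]
  refine and_congr_right fun _ => ?_
  obtain ⟨s, hs, h⟩ := quadraticPart_mk hF hv
  have key : ∀ (c : ℂ), c ≠ 0 → ∀ l m : Module.Dual ℂ (Fin 3 → ℂ),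
      LinearIndependent ℂ ![l, m] → LinearIndependent ℂ ![c • l, c • m] := by
    intro c hc l m hlm
    rw [LinearIndependent.pair_iff] at hlm ⊢
    intro x y hxy
    have := hlm (x * c) (y * c) (by rw [mul_smul, mul_smul, hxy])
    simpa [hc] using this
  constructor
  · rintro ⟨l, m, hlm, H⟩
    refine ⟨s⁻¹ • l, s⁻¹ • m, key _ (inv_ne_zero hs) l m hlm, fun u => ?_⟩
    have := H u
    rw [h] at this
    simp only [LinearMap.smul_apply, smul_eq_mul]
    field_simp
    rw [← this]; ring
  · rintro ⟨l, m, hlm, H⟩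
    refine ⟨s • l, s • m, key _ hs l m hlm, fun u => ?_⟩
    rw [h, H]
    simp only [LinearMap.smul_apply, smul_eq_mul]
    ring

/-- On the cuspidal tangent the coefficients of orders 0, 1, 2 vanish automatically, so multiplicity
three only says that the cubic one does not. -/
theorem isOrdinaryCusp_mk_iff {F : Form} (hF : F.IsHomogeneous 4) {v : Fin 3 → ℂ} (hv : v ≠ 0) :
    IsOrdinaryCusp F (Projectivization.mk ℂ v hv) ↔ CuspAt F v := by
  rw [IsOrdinaryCusp, CuspAt, isSingularPoint_mk_iff hF]
  refine and_congr_right fun hsing => ?_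
  obtain ⟨s, hs, h⟩ := quadraticPart_mk hF hv
  constructor
  · rintro ⟨l, hl, H, H3⟩
    refine ⟨s⁻¹ • l, smul_ne_zero (inv_ne_zero hs) hl, fun u => ?_, fun u hu hlu => ?_⟩
    · have := H u
      rw [h] at this
      simp only [LinearMap.smul_apply, smul_eq_mul]
      field_simp
      rw [← this]; ring
    · have hu0 : u ≠ 0 := hu.ne_zero 1
      have hlu' : l u = 0 := by simpa [hs] using hlu
      have := H3 (Projectivization.mk ℂ u hu0) ((mk_ne_mk_iff hv hu0).2 hu).symm (by
        obtain ⟨b, hb, hb'⟩ := exists_rep_mk hu0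
        rw [hb', map_smul, hlu', smul_zero])
      rw [lineMult_eq_three_iff, Ne, coeff_along_mk_mk_iff hF] at this
      exact this.2
  · rintro ⟨l, hl, H, H3⟩
    refine ⟨s • l, smul_ne_zero hs hl, fun u => ?_, fun q hq hlq => ?_⟩
    · rw [h, H]
      simp only [LinearMap.smul_apply, smul_eq_mul]
      ring
    · have hlq' : l q.rep = 0 := by simpa [hs] using hlq
      have hq' : LinearIndependent ℂ ![v, q.rep] := by
        rw [← mk_ne_mk_iff hv q.rep_nonzero, Projectivization.mk_rep]
        exact hq.symm
      rw [lineMult_eq_three_iff, Ne, coeff_along_mk_iff hF]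
      refine ⟨fun k hk => ?_, H3 _ hq' hlq'⟩
      rw [coeff_along_mk_iff hF]
      interval_cases k
      · rw [coeff_zero_along]; exact hsing.1
      · exact hsing.2 _
      · rw [H, hlq']; simp

theorem isFlex_mk_iff {F : Form} (hF : F.IsHomogeneous 4) {v : Fin 3 → ℂ} (hv : v ≠ 0) :
    IsFlex F (Projectivization.mk ℂ v hv) ↔ FlexAt F v := by
  rw [IsFlex, FlexAt, isSmoothPoint_mk_iff hF]
  refine and_congr_right fun hsm => ?_
  constructor
  · intro H u hu h1
    have hu0 : u ≠ 0 := hu.ne_zero 1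
    have := H (Projectivization.mk ℂ u hu0) ((mk_ne_mk_iff hv hu0).2 hu).symm
      ((onTangentLine_mk_iff hF hv hu0).2 h1)
    rw [three_le_lineMult_iff] at this
    exact (coeff_along_mk_mk_iff hF hv hu0 2).1 (this 2 (by norm_num))
  · intro H q hq ht
    have hq' : LinearIndependent ℂ ![v, q.rep] := by
      rw [← mk_ne_mk_iff hv q.rep_nonzero, Projectivization.mk_rep]
      exact hq.symm
    rw [onTangentLine_iff_rep, coeff_along_mk_iff hF] at ht
    rw [three_le_lineMult_iff]
    intro k hk
    rw [coeff_along_mk_iff hF]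
    interval_cases k
    · rw [coeff_zero_along]; exact hsm.1
    · exact ht
    · exact H _ hq' ht

/-! ### Normal form of a quartic with two cusps and a node -/

theorem exists_coeff_of_isHomogeneous {G : Form} {n : ℕ} (hG : G.IsHomogeneous n) :
    ∃ c : ℕ → ℕ → ℂ, ∀ x y z : ℂ, MvPolynomial.eval ![x, y, z] G =
      ∑ i ∈ Finset.range (n + 1), ∑ j ∈ Finset.range (n + 1 - i),
        c i j * x ^ i * y ^ j * z ^ (n - i - j) := by
  have key : ∀ s : Finset (Fin 3 →₀ ℕ), s ⊆ G.support → ∃ c : ℕ → ℕ → ℂ, ∀ x y z : ℂ,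
      ∑ d ∈ s, G.coeff d * ∏ i, ![x, y, z] i ^ d i =
        ∑ i ∈ Finset.range (n + 1), ∑ j ∈ Finset.range (n + 1 - i),
          c i j * x ^ i * y ^ j * z ^ (n - i - j) := by
    intro s
    induction s using Finset.induction_on with
    | empty => exact fun _ => ⟨0, by simp⟩
    | insert d s hd ih =>
      intro hs
      obtain ⟨c, hc⟩ := ih fun e he => hs (Finset.mem_insert_of_mem he)
      have hdeg : n = d 0 + d 1 + d 2 := by
        rw [← Fin.sum_univ_three, hG.degree_eq_sum_deg_support (hs (Finset.mem_insert_self _ _))]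
        exact Finset.sum_subset (Finset.subset_univ _) (by simp)
      -- The exponents of x and y index a monomial, since the degree fixes that of z.
      refine ⟨fun i j => c i j + if i = d 0 then (if j = d 1 then G.coeff d else 0) else 0,
        fun x y z => ?_⟩
      rw [Finset.sum_insert hd, hc]
      simp only [add_mul, Finset.sum_add_distrib, ite_mul, zero_mul]
      rw [add_comm]
      congr 1
      rw [Finset.sum_eq_single (d 0), Finset.sum_eq_single (d 1), if_pos rfl, if_pos rfl,
        Fin.prod_univ_three, show n - d 0 - d 1 = d 2 by omega]
      · simp; ring
      · intro j _ hj; simp [hj]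
      · intro h; simp at h; omega
      · intro j _ hj; simp [hj]
      · intro h; simp at h; omega
  obtain ⟨c, hc⟩ := key G.support subset_rfl
  exact ⟨c, fun x y z => by rw [MvPolynomial.eval_eq', hc]⟩

/-- The expansion of a quartic form in coordinates with respect to three vectors. -/
theorem exists_coeff_eval {F : Form} (hF : F.IsHomogeneous 4) (v₀ v₁ v₂ : Fin 3 → ℂ) :
    ∃ c : ℕ → ℕ → ℂ, ∀ x y z : ℂ, MvPolynomial.eval (x • v₀ + y • v₁ + z • v₂) F =
      c 0 0 * z ^ 4 + c 0 1 * y * z ^ 3 + c 0 2 * y ^ 2 * z ^ 2 + c 0 3 * y ^ 3 * z +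
      c 0 4 * y ^ 4 + c 1 0 * x * z ^ 3 + c 1 1 * x * y * z ^ 2 + c 1 2 * x * y ^ 2 * z +
      c 1 3 * x * y ^ 3 + c 2 0 * x ^ 2 * z ^ 2 + c 2 1 * x ^ 2 * y * z +
      c 2 2 * x ^ 2 * y ^ 2 + c 3 0 * x ^ 3 * z + c 3 1 * x ^ 3 * y + c 4 0 * x ^ 4 := by
  let L : Fin 3 → Form := fun i => MvPolynomial.C (v₀ i) * MvPolynomial.X 0 +
    MvPolynomial.C (v₁ i) * MvPolynomial.X 1 + MvPolynomial.C (v₂ i) * MvPolynomial.X 2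
  have hL : ∀ i, (L i).IsHomogeneous 1 := fun i =>
    ((MvPolynomial.isHomogeneous_C_mul_X _ _).add (MvPolynomial.isHomogeneous_C_mul_X _ _)).add
      (MvPolynomial.isHomogeneous_C_mul_X _ _)
  obtain ⟨c, hc⟩ := exists_coeff_of_isHomogeneous (hF.aeval L hL)
  refine ⟨c, fun x y z => ?_⟩
  have h := hc x y z
  have h' : MvPolynomial.eval ![x, y, z] (MvPolynomial.aeval L F) =
      MvPolynomial.eval (x • v₀ + y • v₁ + z • v₂) F := by
    rw [MvPolynomial.aeval_def, MvPolynomial.algebraMap_eq, MvPolynomial.eval_eval₂]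
    rw [MvPolynomial.eval]
    congr 1
    · ext; simp
    · ext i; simp [L, mul_comm]
  rw [← h', h]
  simp [Finset.sum_range_succ]
  ring

/-- A line through a cusp and another singular point meets the curve nowhere else. -/
theorem CuspAt.eval_ne_zero {F : Form} (hF : F.IsHomogeneous 4) {v w : Fin 3 → ℂ}
    (hv : CuspAt F v) (hw : SingularAt F w) (hvw : LinearIndependent ℂ ![v, w]) {x y : ℂ}
    (hx : x ≠ 0) (hy : y ≠ 0) : MvPolynomial.eval (x • v + y • w) F ≠ 0 := by
  obtain ⟨c, hc⟩ := exists_coeff_eval hF v w 0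
  obtain ⟨h0, h1, h2, h3⟩ := coeff_along_of_eval (F := F) (v := v) (w := w)
    (c₀ := c 4 0) (c₁ := c 3 1) (c₂ := c 2 2) (c₃ := c 1 3) (c₄ := c 0 4) (fun t => by
      have := hc 1 t 0
      simp only [smul_zero, add_zero, one_smul] at this
      rw [this]; ring)
  obtain ⟨h0', h1', -, -⟩ := coeff_along_of_eval (F := F) (v := w) (w := v)
    (c₀ := c 0 4) (c₁ := c 1 3) (c₂ := c 2 2) (c₃ := c 3 1) (c₄ := c 4 0) (fun t => by
      have := hc t 1 0
      simp only [smul_zero, add_zero, one_smul] at this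
      rw [add_comm, this]; ring)
  obtain ⟨⟨hv0, hv1⟩, l, -, hl, hl3⟩ := hv
  rw [coeff_zero_along, hv0] at h0
  rw [coeff_zero_along, hw.1] at h0'
  rw [hv1] at h1
  rw [hw.2] at h1'
  -- On this line only the x²y² term survives. If it vanished too, the line would be the cuspidal
  -- tangent with zero cubic coefficient, contradicting ordinariness.
  have h22 : c 2 2 ≠ 0 := by
    rw [← h2, hl]
    intro h
    exact hl3 w hvw (pow_eq_zero_iff (two_ne_zero) |>.1 h) (by rw [h3, ← h1'])
  have := hc x y 0
  simp only [smul_zero, add_zero] at this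
  rw [this, ← h0, ← h0', ← h1, ← h1']
  simp [hx, hy, h22]

/-- Otherwise the node would be a third curve point on the line joining the cusps, against
`CuspAt.eval_ne_zero`. -/
theorem linearIndependent_of_cusps {F : Form} (hF : F.IsHomogeneous 4) {v₀ v₁ v₂ : Fin 3 → ℂ}
    (h₀ : CuspAt F v₀) (h₁ : CuspAt F v₁) (h₂ : NodeAt F v₂)
    (h₀₁ : LinearIndependent ℂ ![v₀, v₁]) (h₀₂ : LinearIndependent ℂ ![v₀, v₂])
    (h₁₂ : LinearIndependent ℂ ![v₁, v₂]) : LinearIndependent ℂ ![v₀, v₁, v₂] := by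
  rw [Fintype.linearIndependent_iff]
  intro g hg
  simp only [Fin.sum_univ_three] at hg
  simp at hg
  have h2 : g 2 = 0 := by
    by_contra h2
    have hv2 : v₂ = (-(g 0 / g 2)) • v₀ + (-(g 1 / g 2)) • v₁ := by
      have : (g 2)⁻¹ • (g 0 • v₀ + g 1 • v₁ + g 2 • v₂) = 0 := by rw [hg, smul_zero]
      rw [smul_add, smul_smul, inv_mul_cancel₀ h2, one_smul] at this
      rw [eq_neg_of_add_eq_zero_right this]
      module
    by_cases hx : g 0 = 0
    · rw [hx] at hv2
      have := LinearIndependent.pair_iff.1 h₁₂ (-(g 1 / g 2)) (-1) (by rw [hv2]; module)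
      simp at this
    by_cases hy : g 1 = 0
    · rw [hy] at hv2
      have := LinearIndependent.pair_iff.1 h₀₂ (-(g 0 / g 2)) (-1) (by rw [hv2]; module)
      simp at this
    refine h₀.eval_ne_zero hF h₁.1 h₀₁ (x := -(g 0 / g 2)) (y := -(g 1 / g 2))
      (neg_ne_zero.2 (div_ne_zero hx h2)) (neg_ne_zero.2 (div_ne_zero hy h2)) ?_
    rw [← hv2]
    exact h₂.1.1
  rw [h2, zero_smul, add_zero] at hg
  obtain ⟨h0, h1⟩ := LinearIndependent.pair_iff.1 h₀₁ _ _ hg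
  intro i
  fin_cases i
  exacts [h0, h1, h2]

/-- The form `(xy + xz + yz)² - k xyz²`. -/
def normalForm (k x y z : ℂ) : ℂ :=
  (x * y + x * z + y * z) ^ 2 - k * x * y * z ^ 2

theorem exists_normalForm {F : Form} (hF : F.IsHomogeneous 4) {v₀ v₁ v₂ : Fin 3 → ℂ}
    (h₀ : CuspAt F v₀) (h₁ : CuspAt F v₁) (h₂ : NodeAt F v₂)
    (hli : LinearIndependent ℂ ![v₀, v₁, v₂])
    (h₀₁ : LinearIndependent ℂ ![v₀, v₁]) (h₀₂ : LinearIndependent ℂ ![v₀, v₂])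
    (h₁₂ : LinearIndependent ℂ ![v₁, v₂]) :
    ∃ α β γ C k : ℂ, α ≠ 0 ∧ β ≠ 0 ∧ γ ≠ 0 ∧ C ≠ 0 ∧ k ≠ 0 ∧ k ≠ 4 ∧ ∀ x y z : ℂ,
      MvPolynomial.eval (x • α • v₀ + y • β • v₁ + z • γ • v₂) F = C * normalForm k x y z := by
  obtain ⟨c, hc⟩ := exists_coeff_eval hF v₀ v₁ v₂
  -- These three values will be the coefficients of x²y², x²z² and y²z².
  have e01 := h₀.eval_ne_zero hF h₁.1 h₀₁ one_ne_zero one_ne_zero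
  have e02 := h₀.eval_ne_zero hF h₂.1 h₀₂ one_ne_zero one_ne_zero
  have e12 := h₁.eval_ne_zero hF h₂.1 h₁₂ one_ne_zero one_ne_zero
  obtain ⟨hs0, l, -, hl, -⟩ := h₀
  obtain ⟨hs1, l', -, hl', -⟩ := h₁
  obtain ⟨hs2, m, n, hmn, hq⟩ := h₂
  have A : ∀ q r : ℂ, c 4 0 = 0 ∧ c 3 1 * q + c 3 0 * r = 0 ∧
      c 2 2 * q ^ 2 + c 2 1 * q * r + c 2 0 * r ^ 2 = (q * l v₁ + r * l v₂) ^ 2 := by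
    intro q r
    obtain ⟨h0, h1, h2, -⟩ := coeff_along_of_eval (F := F) (v := v₀) (w := q • v₁ + r • v₂)
      (c₀ := c 4 0) (c₁ := c 3 1 * q + c 3 0 * r)
      (c₂ := c 2 2 * q ^ 2 + c 2 1 * q * r + c 2 0 * r ^ 2)
      (c₃ := c 1 0 * r ^ 3 + c 1 1 * q * r ^ 2 + c 1 2 * q ^ 2 * r + c 1 3 * q ^ 3)
      (c₄ := c 0 0 * r ^ 4 + c 0 1 * q * r ^ 3 + c 0 2 * q ^ 2 * r ^ 2 + c 0 3 * q ^ 3 * r +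
        c 0 4 * q ^ 4) (fun t => by
        have := hc 1 (t * q) (t * r)
        rw [show v₀ + t • (q • v₁ + r • v₂) = (1 : ℂ) • v₀ + (t * q) • v₁ + (t * r) • v₂ by module,
          this]
        ring)
    rw [coeff_zero_along, hs0.1] at h0
    rw [hs0.2] at h1
    rw [hl] at h2
    exact ⟨h0.symm, h1.symm, by rw [← h2]; simp⟩
  have B : ∀ q r : ℂ, c 0 4 = 0 ∧ c 1 3 * q + c 0 3 * r = 0 ∧
      c 2 2 * q ^ 2 + c 1 2 * q * r + c 0 2 * r ^ 2 = (q * l' v₀ + r * l' v₂) ^ 2 := by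
    intro q r
    obtain ⟨h0, h1, h2, -⟩ := coeff_along_of_eval (F := F) (v := v₁) (w := q • v₀ + r • v₂)
      (c₀ := c 0 4) (c₁ := c 1 3 * q + c 0 3 * r)
      (c₂ := c 2 2 * q ^ 2 + c 1 2 * q * r + c 0 2 * r ^ 2)
      (c₃ := c 0 1 * r ^ 3 + c 1 1 * q * r ^ 2 + c 2 1 * q ^ 2 * r + c 3 1 * q ^ 3)
      (c₄ := c 0 0 * r ^ 4 + c 1 0 * q * r ^ 3 + c 2 0 * q ^ 2 * r ^ 2 + c 3 0 * q ^ 3 * r +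
        c 4 0 * q ^ 4) (fun t => by
        have := hc (t * q) 1 (t * r)
        rw [show v₁ + t • (q • v₀ + r • v₂) = (t * q) • v₀ + (1 : ℂ) • v₁ + (t * r) • v₂ by module,
          this]
        ring)
    rw [coeff_zero_along, hs1.1] at h0
    rw [hs1.2] at h1
    rw [hl'] at h2
    exact ⟨h0.symm, h1.symm, by rw [← h2]; simp⟩
  have D : ∀ q r s : ℂ, c 0 0 = 0 ∧ 4 * c 0 0 * s + c 1 0 * q + c 0 1 * r = 0 ∧
      6 * c 0 0 * s ^ 2 + 3 * (c 1 0 * q + c 0 1 * r) * s +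
        c 2 0 * q ^ 2 + c 1 1 * q * r + c 0 2 * r ^ 2 =
        (q * m v₀ + r * m v₁ + s * m v₂) * (q * n v₀ + r * n v₁ + s * n v₂) := by
    intro q r s
    obtain ⟨h0, h1, h2, -⟩ := coeff_along_of_eval (F := F) (v := v₂)
      (w := q • v₀ + r • v₁ + s • v₂)
      (c₀ := c 0 0) (c₁ := 4 * c 0 0 * s + c 1 0 * q + c 0 1 * r)
      (c₂ := 6 * c 0 0 * s ^ 2 + 3 * (c 1 0 * q + c 0 1 * r) * s +
        c 2 0 * q ^ 2 + c 1 1 * q * r + c 0 2 * r ^ 2)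
      (c₃ := 4 * c 0 0 * s ^ 3 + 3 * (c 1 0 * q + c 0 1 * r) * s ^ 2 +
        2 * (c 2 0 * q ^ 2 + c 1 1 * q * r + c 0 2 * r ^ 2) * s +
        c 0 3 * r ^ 3 + c 1 2 * q * r ^ 2 + c 2 1 * q ^ 2 * r + c 3 0 * q ^ 3)
      (c₄ := c 0 0 * s ^ 4 + (c 1 0 * q + c 0 1 * r) * s ^ 3 +
        (c 2 0 * q ^ 2 + c 1 1 * q * r + c 0 2 * r ^ 2) * s ^ 2 +
        (c 0 3 * r ^ 3 + c 1 2 * q * r ^ 2 + c 2 1 * q ^ 2 * r + c 3 0 * q ^ 3) * s +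
        c 0 4 * r ^ 4 + c 1 3 * q * r ^ 3 + c 2 2 * q ^ 2 * r ^ 2 + c 3 1 * q ^ 3 * r +
        c 4 0 * q ^ 4) (fun t => by
        have := hc (t * q) (t * r) (1 + t * s)
        rw [show v₂ + t • (q • v₀ + r • v₁ + s • v₂) =
          (t * q) • v₀ + (t * r) • v₁ + (1 + t * s) • v₂ by module, this]
        ring)
    rw [coeff_zero_along, hs2.1] at h0
    rw [hs2.2] at h1
    rw [hq] at h2
    exact ⟨h0.symm, h1.symm, by rw [← h2]; simp⟩
  have z40 := (A 0 0).1
  have z31 : c 3 1 = 0 := by simpa using (A 1 0).2.1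
  have z30 : c 3 0 = 0 := by simpa using (A 0 1).2.1
  have z04 := (B 0 0).1
  have z13 : c 1 3 = 0 := by simpa using (B 1 0).2.1
  have z03 : c 0 3 = 0 := by simpa using (B 0 1).2.1
  have z00 := (D 0 0 0).1
  have z10 : c 1 0 = 0 := by simpa using (D 1 0 0).2.1
  have z01 : c 0 1 = 0 := by simpa using (D 0 1 0).2.1
  simp only [z40, z31, z30, z04, z13, z03, z00, z10, z01, zero_mul, zero_add, add_zero, mul_zero]
    at hc D
  have a0 : c 2 2 ≠ 0 := by
    have := hc 1 1 0
    simp only [zero_smul, add_zero] at this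
    rw [this] at e01
    simpa using e01
  have b0 : c 0 2 ≠ 0 := by
    have := hc 0 1 1
    simp only [zero_smul, zero_add] at this
    rw [this] at e12
    simpa using e12
  have c0 : c 2 0 ≠ 0 := by
    have := hc 1 0 1
    simp only [zero_smul, add_zero] at this
    rw [this] at e02
    simpa using e02
  -- The quadratic part at the cusp `v₀` is the square of l, so its middle coefficient is twice
  -- l(v₁)l(v₂).
  obtain ⟨d, hd, hdd⟩ : ∃ d, c 2 1 = 2 * d ∧ d ^ 2 = c 2 2 * c 2 0 := by
    have h1 := (A 1 0).2.2
    have h2 := (A 0 1).2.2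
    have h3 := (A 1 1).2.2
    refine ⟨l v₁ * l v₂, by linear_combination h3 - h1 - h2, ?_⟩
    have h1' : c 2 2 = l v₁ ^ 2 := by linear_combination h1
    have h2' : c 2 0 = l v₂ ^ 2 := by linear_combination h2
    rw [h1', h2']; ring
  obtain ⟨e, he, hee⟩ : ∃ e, c 1 2 = 2 * e ∧ e ^ 2 = c 2 2 * c 0 2 := by
    have h1 := (B 1 0).2.2
    have h2 := (B 0 1).2.2
    have h3 := (B 1 1).2.2
    refine ⟨l' v₀ * l' v₂, by linear_combination h3 - h1 - h2, ?_⟩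
    have h1' : c 2 2 = l' v₀ ^ 2 := by linear_combination h1
    have h2' : c 0 2 = l' v₂ ^ 2 := by linear_combination h2
    rw [h1', h2']; ring
  -- With zero discriminant, the two factors of the tangent cone at the node would be proportional
  -- on `v₀`, `v₁` and both zero on `v₂`, hence dependent.
  have hdisc : c 1 1 ^ 2 ≠ 4 * c 2 0 * c 0 2 := by
    intro hdisc
    have d1 := (D 1 0 0).2.2
    have d2 := (D 0 1 0).2.2
    have d3 := (D 1 1 0).2.2
    have d4 := (D 0 0 1).2.2
    have d5 := (D 1 0 1).2.2
    simp at d1 d2 d3 d4 d5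
    have hm0 : m v₀ ≠ 0 := by intro h; rw [h, zero_mul] at d1; exact c0 d1
    have hn0 : n v₀ ≠ 0 := by intro h; rw [h, mul_zero] at d1; exact c0 d1
    have hz : m v₂ = 0 ∧ n v₂ = 0 := by
      rcases d4 with h | h
      · refine ⟨h, ?_⟩
        rw [h, d1] at d5
        have : m v₀ * n v₂ = 0 := by linear_combination -d5
        simpa [hm0] using this
      · refine ⟨?_, h⟩
        rw [h, d1] at d5
        have : m v₂ * n v₀ = 0 := by linear_combination -d5
        simpa [hn0] using this
    have hx : m v₀ * n v₁ - m v₁ * n v₀ = 0 := by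
      have h11 : c 1 1 = m v₀ * n v₁ + m v₁ * n v₀ := by linear_combination d3 - d1 - d2
      rw [h11, d1, d2] at hdisc
      have : (m v₀ * n v₁ - m v₁ * n v₀) ^ 2 = 0 := by linear_combination hdisc
      exact pow_eq_zero_iff two_ne_zero |>.1 this
    have hzero : n v₀ • m + (-m v₀) • n = 0 := by
      have hb : ∀ i, (n v₀ • m + (-m v₀) • n) (![v₀, v₁, v₂] i) = 0 := by
        intro i
        fin_cases i
        · simp; ring
        · simp; linear_combination -hx
        · simp [hz.1, hz.2]
      have hspan := hli.span_eq_top_of_card_eq_finrank (by simp)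
      exact LinearMap.ext_on_range hspan hb
    exact hn0 (LinearIndependent.pair_iff.1 hmn _ _ hzero).1
  have d0 : d ≠ 0 := by
    rintro rfl
    exact mul_ne_zero a0 c0 (by rw [← hdd]; simp)
  have e0 : e ≠ 0 := by
    rintro rfl
    exact mul_ne_zero a0 b0 (by rw [← hee]; simp)
  -- This is (k − 2)² ≠ 4, which excludes both k = 0 and k = 4.
  have hk : (2 - c 1 1 * c 2 2 / (e * d) - 2) ^ 2 ≠ 4 := by
    intro h
    apply hdisc
    have : (c 1 1) ^ 2 * c 2 2 ^ 2 = 4 * (e ^ 2 * d ^ 2) := by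
      field_simp at h
      linear_combination h
    rw [hdd, hee] at this
    have h' : c 2 2 ^ 2 * (c 1 1 ^ 2 - 4 * c 2 0 * c 0 2) = 0 := by linear_combination this
    rw [mul_eq_zero, sub_eq_zero] at h'
    exact h'.resolve_left (pow_ne_zero 2 a0)
  -- This scaling gives x²y², x²z² and y²z² the common coefficient C, and x²yz and xy²z the
  -- coefficient 2C; k is then read off from xyz².
  refine ⟨e, d, c 2 2, c 2 2 * e ^ 2 * d ^ 2, 2 - c 1 1 * c 2 2 / (e * d), e0, d0, a0,
    by simp [a0, e0, d0], ?_, ?_, fun x y z => ?_⟩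
  · intro h; rw [h] at hk; norm_num at hk
  · intro h; rw [h] at hk; norm_num at hk
  · simp only [smul_smul, hc, normalForm, hd, he]
    field_simp
    linear_combination (-y ^ 2 * z ^ 2 * d ^ 2) * hee +
      (-x ^ 2 * z ^ 2 * e ^ 2) * hdd

/-! ### Tangents and flexes through the rational parametrization -/

/-- The polar form of `normalForm` at `u`: its derivative at `u` in direction `w`. -/
def polarForm (k : ℂ) (u w : Fin 3 → ℂ) : ℂ :=
  2 * (u 0 * u 1 + u 0 * u 2 + u 1 * u 2) *
      (u 0 * w 1 + u 1 * w 0 + u 0 * w 2 + u 2 * w 0 + u 1 * w 2 + u 2 * w 1) -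
    k * (w 0 * u 1 * u 2 ^ 2 + u 0 * w 1 * u 2 ^ 2 + 2 * u 0 * u 1 * u 2 * w 2)

/-- The degree two part of the expansion of `normalForm` at `u` in direction `w`. -/
def hessForm (k : ℂ) (u w : Fin 3 → ℂ) : ℂ :=
  (u 0 * w 1 + u 1 * w 0 + u 0 * w 2 + u 2 * w 0 + u 1 * w 2 + u 2 * w 1) ^ 2 +
    2 * (u 0 * u 1 + u 0 * u 2 + u 1 * u 2) * (w 0 * w 1 + w 0 * w 2 + w 1 * w 2) -
    k * (w 0 * w 1 * u 2 ^ 2 + 2 * u 2 * w 2 * (w 0 * u 1 + u 0 * w 1) + u 0 * u 1 * w 2 ^ 2)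

/-- The degree three part of the expansion of `normalForm` at `u` in direction `w`. -/
def cubicForm (k : ℂ) (u w : Fin 3 → ℂ) : ℂ :=
  2 * (u 0 * w 1 + u 1 * w 0 + u 0 * w 2 + u 2 * w 0 + u 1 * w 2 + u 2 * w 1) *
      (w 0 * w 1 + w 0 * w 2 + w 1 * w 2) -
    k * (2 * u 2 * w 0 * w 1 * w 2 + w 2 ^ 2 * (w 0 * u 1 + u 0 * w 1))

theorem coeff_along_normalForm {F : Form} {S : (Fin 3 → ℂ) ≃ₗ[ℂ] (Fin 3 → ℂ)} {C k : ℂ}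
    (hS : ∀ u, MvPolynomial.eval (S u) F = C * normalForm k (u 0) (u 1) (u 2))
    (u w : Fin 3 → ℂ) :
    (along F (S u) (S w)).coeff 1 = C * polarForm k u w ∧
      (along F (S u) (S w)).coeff 2 = C * hessForm k u w ∧
      (along F (S u) (S w)).coeff 3 = C * cubicForm k u w := by
  have := coeff_along_of_eval (F := F) (v := S u) (w := S w)
    (c₀ := C * normalForm k (u 0) (u 1) (u 2)) (c₁ := C * polarForm k u w)
    (c₂ := C * hessForm k u w)
    (c₃ := C * cubicForm k u w)
    (c₄ := C * ((w 0 * w 1 + w 0 * w 2 + w 1 * w 2) ^ 2 - k * w 0 * w 1 * w 2 ^ 2))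
    (fun t => by
      rw [← map_smul, ← map_add, hS]
      simp only [normalForm, polarForm, hessForm, cubicForm, Pi.add_apply,
        Pi.smul_apply, smul_eq_mul]
      ring)
  exact this.2

/-- A rational parametrization of the curve `normalForm (κ ^ 2) = 0`. -/
def param (κ m : ℂ) : Fin 3 → ℂ :=
  ![κ * m - m ^ 2 - 1, m ^ 2 * (κ * m - m ^ 2 - 1), m ^ 2]

theorem param_ne_zero (κ : ℂ) {m : ℂ} (hm : m ≠ 0) : param κ m ≠ 0 := by
  intro h
  have := congrFun h 2
  simp [param, hm] at this

/-- The points of the curve off the coordinate lines are given by the parametrization. -/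
theorem eq_smul_param {κ x y z : ℂ} (h : normalForm (κ ^ 2) x y z = 0) (hx : x ≠ 0)
    (hy : y ≠ 0) (hz : z ≠ 0) :
    ∃ m a : ℂ, m ≠ 0 ∧ κ * m - m ^ 2 - 1 ≠ 0 ∧ a ≠ 0 ∧ ![x, y, z] = a • param κ m := by
  -- With y = s²x the equation is a difference of two squares; the vanishing factor decides which of
  -- ±s is the parameter.
  obtain ⟨s, hs⟩ := IsAlgClosed.exists_pow_nat_eq (y / x) (n := 2) (by norm_num)
  have hs' : y = s ^ 2 * x := by rw [hs]; field_simp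
  have hfac : (x * y + x * z + y * z - κ * z * x * s) *
      (x * y + x * z + y * z - κ * z * x * (-s)) = 0 := by
    have : (x * y + x * z + y * z) ^ 2 = κ ^ 2 * x * y * z ^ 2 := by
      rw [normalForm] at h
      linear_combination h
    linear_combination this + κ ^ 2 * x * z ^ 2 * hs'
  obtain ⟨m, hm, hm'⟩ : ∃ m, y = m ^ 2 * x ∧ x * y + x * z + y * z - κ * z * x * m = 0 := by
    rcases mul_eq_zero.1 hfac with h | h
    · exact ⟨s, hs', h⟩
    · exact ⟨-s, by rw [hs']; ring, h⟩
  have hm0 : m ≠ 0 := by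
    rintro rfl
    exact hy (by rw [hm]; simp)
  have hW : m ^ 2 * x = z * (κ * m - m ^ 2 - 1) := by
    have : x * (m ^ 2 * x - z * (κ * m - m ^ 2 - 1)) = 0 := by
      linear_combination hm' - (x + z) * hm
    rcases mul_eq_zero.1 this with h | h
    · exact absurd h hx
    · linear_combination h
  refine ⟨m, z / m ^ 2, hm0, ?_, by simp [hm0, hz], ?_⟩
  · intro h0
    rw [h0, mul_zero] at hW
    exact mul_ne_zero (pow_ne_zero 2 hm0) hx hW
  · ext i
    fin_cases i
    · simp [param]; field_simp; linear_combination hW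
    · simp [param]; field_simp; linear_combination hm + hW
    · simp [param]; field_simp

/-- Tangency at m produces the double root n = m; the last factor gives the two residual
intersections. -/
theorem polarForm_param_param (κ m n : ℂ) :
    polarForm (κ ^ 2) (param κ m) (param κ n) =
      -κ * m ^ 3 * (κ * m - m ^ 2 - 1) * (n - m) ^ 2 *
        ((κ * m - 2) * n ^ 2 + (2 - κ * m) * (κ - 2 * m) * n + m * (κ - 2 * m)) := by
  simp only [polarForm, param]
  simp
  ring

/-- The derivative of the parametrization. -/
def paramDeriv (κ m : ℂ) : Fin 3 → ℂ :=
  ![κ - 2 * m, 2 * m * (κ * m - m ^ 2 - 1) + m ^ 2 * (κ - 2 * m), 2 * m]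

theorem polarForm_param_paramDeriv (κ m : ℂ) :
    polarForm (κ ^ 2) (param κ m) (paramDeriv κ m) = 0 := by
  simp only [polarForm, param, paramDeriv]
  simp
  ring

/-- The velocity vector spans the tangent line with the point, so the last factor is the flex
equation. -/
theorem hessForm_param_paramDeriv (κ m : ℂ) :
    hessForm (κ ^ 2) (param κ m) (paramDeriv κ m) =
      κ * m ^ 4 * (κ * m - m ^ 2 - 1) * (3 * κ * m ^ 2 - (8 + κ ^ 2) * m + 3 * κ) := by
  simp only [hessForm, param, paramDeriv]
  simp
  ring

theorem linearIndependent_param_paramDeriv {κ m : ℂ} (hm : m ≠ 0)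
    (hW : κ * m - m ^ 2 - 1 ≠ 0) : LinearIndependent ℂ ![param κ m, paramDeriv κ m] := by
  rw [LinearIndependent.pair_iff]
  intro s t h
  have h0 := congrFun h 0
  have h1 := congrFun h 1
  simp [param, paramDeriv] at h0 h1
  have ht : t * (m * (κ * m - m ^ 2 - 1)) = 0 := by linear_combination (h1 - m ^ 2 * h0) / 2
  have ht0 : t = 0 := by simpa [hm, hW] using ht
  rw [ht0] at h0
  exact ⟨by simpa [hW] using h0, ht0⟩

theorem linearIndependent_pair_map (S : (Fin 3 → ℂ) ≃ₗ[ℂ] (Fin 3 → ℂ)) {a b : Fin 3 → ℂ}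
    (h : LinearIndependent ℂ ![a, b]) : LinearIndependent ℂ ![S a, S b] := by
  rw [LinearIndependent.pair_iff] at h ⊢
  intro s t hst
  rw [← map_smul, ← map_smul, ← map_add, S.map_eq_zero_iff] at hst
  exact h s t hst

/-- The parameter of a flex is a root of a quadratic equation. -/
theorem FlexAt.quadratic {F : Form} {S : (Fin 3 → ℂ) ≃ₗ[ℂ] (Fin 3 → ℂ)} {C κ m : ℂ}
    (hC : C ≠ 0) (hκ : κ ≠ 0)
    (hS : ∀ u, MvPolynomial.eval (S u) F = C * normalForm (κ ^ 2) (u 0) (u 1) (u 2))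
    (hm : m ≠ 0) (hW : κ * m - m ^ 2 - 1 ≠ 0) (h : FlexAt F (S (param κ m))) :
    3 * κ * m ^ 2 - (8 + κ ^ 2) * m + 3 * κ = 0 := by
  have hc := coeff_along_normalForm hS (param κ m) (paramDeriv κ m)
  have hli : LinearIndependent ℂ ![S (param κ m), S (paramDeriv κ m)] :=
    linearIndependent_pair_map S (linearIndependent_param_paramDeriv hm hW)
  have := h.2 _ hli (by rw [hc.1, polarForm_param_paramDeriv, mul_zero])
  rw [hc.2.1, hessForm_param_paramDeriv] at this
  simpa [hC, hκ, hm, hW] using this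

/-- The residual intersection of a flex tangent with the curve. -/
theorem residual_param {κ m n : ℂ} (hκ : κ ≠ 0) (hk : κ ^ 2 ≠ 4) (hm : m ≠ 0)
    (hW : κ * m - m ^ 2 - 1 ≠ 0) (hflex : 3 * κ * m ^ 2 - (8 + κ ^ 2) * m + 3 * κ = 0)
    (hnm : n ≠ m) (h : polarForm (κ ^ 2) (param κ m) (param κ n) = 0) : n = κ - 3 * m := by
  rw [polarForm_param_param] at h
  have h1 : (κ * m - 2) * n ^ 2 + (2 - κ * m) * (κ - 2 * m) * n + m * (κ - 2 * m) = 0 := by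
    simpa [hκ, hm, hW, sub_eq_zero, hnm] using h
  -- At a flex the residual quadratic has the root m again, and its roots sum to κ − 2m.
  have h2 : (κ * m - 2) * ((n - m) * (n - (κ - 3 * m))) = 0 := by
    linear_combination h1 - m * hflex
  -- Substituting κm = 2 into κ times the flex equation leaves κ² − 4.
  have h3 : κ * m - 2 ≠ 0 := by
    intro h3
    apply hk
    linear_combination κ * hflex + (2 - 3 * κ * m + κ ^ 2) * h3
  rcases mul_eq_zero.1 h2 with h | h
  · exact absurd h h3
  · rcases mul_eq_zero.1 h with h | h
    · exact absurd (sub_eq_zero.1 h) hnm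
    · exact sub_eq_zero.1 h

theorem flex_parameters {κ m₁ m₂ : ℂ}
    (h₁ : 3 * κ * m₁ ^ 2 - (8 + κ ^ 2) * m₁ + 3 * κ = 0)
    (h₂ : 3 * κ * m₂ ^ 2 - (8 + κ ^ 2) * m₂ + 3 * κ = 0) (hne : m₁ ≠ m₂)
    (h : (κ - 3 * m₁) ^ 2 = (κ - 3 * m₂) ^ 2) :
    ∃ r : ℂ, r ^ 2 = -2 ∧ κ ^ 2 = 8 ∧ m₁ = κ * (4 - r) / 12 ∧ m₂ = κ * (4 + r) / 12 := by
  have hne' : m₁ - m₂ ≠ 0 := sub_ne_zero.2 hne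
  have hsum : 2 * κ = 3 * (m₁ + m₂) := by
    have : (m₁ - m₂) * (2 * κ - 3 * (m₁ + m₂)) = 0 := by linear_combination -h / 3
    rcases mul_eq_zero.1 this with h | h
    · exact absurd h hne'
    · linear_combination h
  have hq : 3 * κ * (m₁ + m₂) = 8 + κ ^ 2 := by
    have : (m₁ - m₂) * (3 * κ * (m₁ + m₂) - (8 + κ ^ 2)) = 0 := by linear_combination h₁ - h₂
    rcases mul_eq_zero.1 this with h | h
    · exact absurd h hne'
    · linear_combination h
  have hk : κ ^ 2 = 8 := by linear_combination hq + κ * hsum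
  -- This r is κn₁/2 for the residual parameter n₁; it satisfies n₁² = −1.
  refine ⟨κ * (κ - 3 * m₁) / 2, ?_, hk, ?_, ?_⟩
  · have : κ * m₁ ^ 2 * 3 = 16 * m₁ - 3 * κ := by linear_combination h₁ + m₁ * hk
    linear_combination ((κ ^ 2 - 6 * κ * m₁ - 1) / 4) * hk + (3 * κ / 4) * this
  · linear_combination (κ - 3 * m₁) / 24 * hk
  · linear_combination (-κ + 3 * m₁) / 24 * hk - hsum / 3

/-! ### Rigidity: reduction of a configuration to the standard one -/

theorem mk_eq_mk_of_smul {v w : Fin 3 → ℂ} (hv : v ≠ 0) (hw : w ≠ 0) (a : ℂ) (h : a • w = v) :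
    Projectivization.mk ℂ v hv = Projectivization.mk ℂ w hw :=
  (Projectivization.mk_eq_mk_iff' ℂ v w hv hw).2 ⟨a, h⟩

/-- Coordinates in which a quartic with two cusps and a node is in normal form. -/
theorem IsConfiguration.exists_frame {F : Form} {p : Fin 7 → Plane} (h : IsConfiguration F p) :
    ∃ (S : (Fin 3 → ℂ) ≃ₗ[ℂ] (Fin 3 → ℂ)) (C κ : ℂ), C ≠ 0 ∧ κ ≠ 0 ∧ κ ^ 2 ≠ 4 ∧
      (∀ u, MvPolynomial.eval (S u) F = C * normalForm (κ ^ 2) (u 0) (u 1) (u 2)) ∧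
      (∃ h0, p 2 = Projectivization.mk ℂ (S ![1, 0, 0]) h0) ∧
      (∃ h0, p 1 = Projectivization.mk ℂ (S ![0, 1, 0]) h0) ∧
      (∃ h0, p 0 = Projectivization.mk ℂ (S ![0, 0, 1]) h0) := by
  have hF := h.quartic.2
  have hc0 : CuspAt F (p 2).rep := by
    rw [← isOrdinaryCusp_mk_iff hF (p 2).rep_nonzero, Projectivization.mk_rep]; exact h.cusp₃
  have hc1 : CuspAt F (p 1).rep := by
    rw [← isOrdinaryCusp_mk_iff hF (p 1).rep_nonzero, Projectivization.mk_rep]; exact h.cusp₂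
  have hn : NodeAt F (p 0).rep := by
    rw [← isNode_mk_iff hF (p 0).rep_nonzero, Projectivization.mk_rep]; exact h.node
  have hpair : ∀ i j, i ≠ j → LinearIndependent ℂ ![(p i).rep, (p j).rep] := fun i j hij => by
    rw [← mk_ne_mk_iff (p i).rep_nonzero (p j).rep_nonzero, Projectivization.mk_rep,
      Projectivization.mk_rep]
    exact h.distinct.ne hij
  have h01 := hpair 2 1 (by decide)
  have h02 := hpair 2 0 (by decide)
  have h12 := hpair 1 0 (by decide)
  have hli := linearIndependent_of_cusps hF hc0 hc1 hn h01 h02 h12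
  obtain ⟨α, β, γ, C, k, hα, hβ, hγ, hC, hk0, hk4, hev⟩ :=
    exists_normalForm hF hc0 hc1 hn hli h01 h02 h12
  have hli' : LinearIndependent ℂ ![α • (p 2).rep, β • (p 1).rep, γ • (p 0).rep] := by
    have := hli.units_smul ![Units.mk0 α hα, Units.mk0 β hβ, Units.mk0 γ hγ]
    have e : ![α • (p 2).rep, β • (p 1).rep, γ • (p 0).rep] =
        ![Units.mk0 α hα, Units.mk0 β hβ, Units.mk0 γ hγ] •
          ![(p 2).rep, (p 1).rep, (p 0).rep] := by
      ext i j
      fin_cases i <;> rfl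
    rwa [e]
  obtain ⟨κ, hκ⟩ := IsAlgClosed.exists_pow_nat_eq k (n := 2) (by norm_num)
  let S := (basisOfLinearIndependentOfCardEqFinrank hli' (by simp)).equivFun.symm
  have hS : ∀ u, S u = u 0 • α • (p 2).rep + u 1 • β • (p 1).rep + u 2 • γ • (p 0).rep := by
    intro u
    simp only [S, Module.Basis.equivFun_symm_apply, Fin.sum_univ_three,
      coe_basisOfLinearIndependentOfCardEqFinrank]
    rfl
  have hne : ∀ u : Fin 3 → ℂ, u ≠ 0 → S u ≠ 0 := fun u hu => by simpa using hu
  refine ⟨S, C, κ, hC, ?_, by rwa [hκ], fun u => by rw [hS, hev, hκ],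
    ⟨hne _ (by simp), ?_⟩, ⟨hne _ (by simp), ?_⟩, ⟨hne _ (by simp), ?_⟩⟩
  · rintro rfl
    exact hk0 (by rw [← hκ]; simp)
  · conv_lhs => rw [← Projectivization.mk_rep (p 2)]
    exact mk_eq_mk_of_smul _ _ α⁻¹ (by rw [hS]; simp [smul_smul, hα])
  · conv_lhs => rw [← Projectivization.mk_rep (p 1)]
    exact mk_eq_mk_of_smul _ _ β⁻¹ (by rw [hS]; simp [smul_smul, hβ])
  · conv_lhs => rw [← Projectivization.mk_rep (p 0)]
    exact mk_eq_mk_of_smul _ _ γ⁻¹ (by rw [hS]; simp [smul_smul, hγ])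

/-- Setting one coordinate to zero leaves the square of the product of the other two, so the
coordinate lines meet the curve only at the vertices. -/
theorem exists_eq_mk_param {F : Form} (hF : F.IsHomogeneous 4)
    {S : (Fin 3 → ℂ) ≃ₗ[ℂ] (Fin 3 → ℂ)} {C κ : ℂ} (hC : C ≠ 0)
    (hS : ∀ u, MvPolynomial.eval (S u) F = C * normalForm (κ ^ 2) (u 0) (u 1) (u 2))
    {q : Plane} (hq : OnCurve F q)
    (h₀ : ∀ h0, q ≠ Projectivization.mk ℂ (S ![1, 0, 0]) h0)
    (h₁ : ∀ h0, q ≠ Projectivization.mk ℂ (S ![0, 1, 0]) h0)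
    (h₂ : ∀ h0, q ≠ Projectivization.mk ℂ (S ![0, 0, 1]) h0) :
    ∃ m, m ≠ 0 ∧ κ * m - m ^ 2 - 1 ≠ 0 ∧ ∃ h0, q = Projectivization.mk ℂ (S (param κ m)) h0 := by
  have hne : ∀ u : Fin 3 → ℂ, u ≠ 0 → S u ≠ 0 := fun u hu => by simpa using hu
  obtain ⟨u, hu⟩ := S.surjective q.rep
  have hu0 : S u ≠ 0 := hu ▸ q.rep_nonzero
  have hqu : q = Projectivization.mk ℂ (S u) hu0 := by
    simp only [hu]; exact q.mk_rep.symm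
  have hnf : normalForm (κ ^ 2) (u 0) (u 1) (u 2) = 0 := by
    rw [hqu, onCurve_mk_iff hF, hS] at hq
    simpa [hC] using hq
  have key : ∀ w : Fin 3 → ℂ, w ≠ 0 → (∀ h0, q ≠ Projectivization.mk ℂ (S w) h0) →
      ∀ a : ℂ, u ≠ a • w := by
    intro w hw hqw a ha
    refine hqw (hne w hw) ?_
    rw [hqu]
    exact mk_eq_mk_of_smul _ _ a (by rw [ha, map_smul])
  have k0 : ¬ (u 1 = 0 ∧ u 2 = 0) := fun h => key _ (by simp) h₀ (u 0) (by
    ext i; fin_cases i <;> simp [h.1, h.2])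
  have k1 : ¬ (u 0 = 0 ∧ u 2 = 0) := fun h => key _ (by simp) h₁ (u 1) (by
    ext i; fin_cases i <;> simp [h.1, h.2])
  have k2 : ¬ (u 0 = 0 ∧ u 1 = 0) := fun h => key _ (by simp) h₂ (u 2) (by
    ext i; fin_cases i <;> simp [h.1, h.2])
  rw [normalForm] at hnf
  have hx : u 0 ≠ 0 := by
    intro hx
    rw [hx] at hnf
    simp at hnf
    tauto
  have hy : u 1 ≠ 0 := by
    intro hy
    rw [hy] at hnf
    simp at hnf
    tauto
  have hz : u 2 ≠ 0 := by
    intro hz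
    rw [hz] at hnf
    simp at hnf
    tauto
  obtain ⟨m, a, hm, hW, ha, hua⟩ := eq_smul_param hnf hx hy hz
  refine ⟨m, hm, hW, hne _ (param_ne_zero κ hm), ?_⟩
  rw [hqu]
  refine mk_eq_mk_of_smul _ _ a ?_
  rw [← map_smul, ← hua]
  congr 1
  ext i; fin_cases i <;> rfl

theorem linearIndependent_triple_map (S : (Fin 3 → ℂ) ≃ₗ[ℂ] (Fin 3 → ℂ)) {a b c : Fin 3 → ℂ}
    (h : LinearIndependent ℂ ![a, b, c]) : LinearIndependent ℂ ![S a, S b, S c] := by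
  rw [Fintype.linearIndependent_iff] at h ⊢
  intro g hg
  refine h g ?_
  rw [Fin.sum_univ_three] at hg ⊢
  rw [← S.map_eq_zero_iff]
  simpa using hg

/-- Two curve points on a line through the node have parameters with equal squares. -/
theorem sq_eq_sq_of_not_linearIndependent {κ m n : ℂ}
    (hm : κ * m - m ^ 2 - 1 ≠ 0) (hn : κ * n - n ^ 2 - 1 ≠ 0)
    (h : ¬ LinearIndependent ℂ ![![0, 0, 1], param κ m, param κ n]) : m ^ 2 = n ^ 2 := by
  by_contra hne
  apply h
  have := Matrix.linearIndependent_rows_of_det_ne_zero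
    (A := Matrix.of ![![0, 0, 1], param κ m, param κ n]) (by
      rw [Matrix.det_fin_three]
      simp only [param, Matrix.of_apply]
      simp
      intro h0
      apply hne
      have : (κ * m - m ^ 2 - 1) * (κ * n - n ^ 2 - 1) * (n ^ 2 - m ^ 2) = 0 := by
        linear_combination h0
      simp only [mul_eq_zero, hm, hn, false_or] at this
      linear_combination -this)
  exact this

/-- The linear map `(x, y, w) ↦ (x, y, w + x + y)`. -/
def shear : (Fin 3 → ℂ) ≃ₗ[ℂ] (Fin 3 → ℂ) where
  toFun u := ![u 0, u 1, u 2 + u 0 + u 1]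
  invFun u := ![u 0, u 1, u 2 - u 0 - u 1]
  map_add' u v := by ext i; fin_cases i <;> simp; ring
  map_smul' a u := by ext i; fin_cases i <;> simp; ring
  left_inv u := by ext i; fin_cases i <;> simp; ring
  right_inv u := by ext i; fin_cases i <;> simp; ring

/-- With w = z − x − y one has x²+xy+y²−xz−yz = −(xy+xw+yw). -/
theorem eval_stdQuartic (v : Fin 3 → ℂ) :
    MvPolynomial.eval v stdQuartic = normalForm 8 (v 0) (v 1) (v 2 - v 0 - v 1) := by
  simp [stdQuartic, normalForm]
  ring

theorem eval_bind₁_toMvPolynomial (T : (Fin 3 → ℂ) ≃ₗ[ℂ] (Fin 3 → ℂ)) (G : Form)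
    (v : Fin 3 → ℂ) :
    MvPolynomial.eval v (MvPolynomial.bind₁ (LinearMap.toMatrix' T.toLinearMap).toMvPolynomial G) =
      MvPolynomial.eval (T v) G := by
  rw [MvPolynomial.bind₁, MvPolynomial.aeval_def, MvPolynomial.algebraMap_eq,
    MvPolynomial.eval_eval₂, MvPolynomial.eval]
  congr 1
  · ext; simp
  · ext i
    rw [← MvPolynomial.eval, Matrix.toMvPolynomial_eval_eq_apply, LinearMap.toMatrix'_mulVec]
    rfl

/-- `param` involves m only through m² and κm, so the sign of κ drops out. -/
theorem param_flex {κ s : ℂ} (hκ : κ ^ 2 = 8) (hs : s ^ 2 = -2) :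
    param κ (κ * (4 - s) / 12) = ((7 - 4 * s) / 81) • ![8 + 2 * s, 8 - 2 * s, 9] := by
  have h1 : (κ * (4 - s) / 12) ^ 2 = (7 - 4 * s) / 9 := by
    linear_combination ((4 - s) ^ 2 / 144) * hκ + (1 / 18) * hs
  have h2 : κ * (κ * (4 - s) / 12) = (8 - 2 * s) / 3 := by
    linear_combination ((4 - s) / 12) * hκ
  simp only [param, h1, h2]
  ext i
  fin_cases i
  · simp
    linear_combination (8 / 81) * hs
  · simp
    ring
  · simp
    ring

theorem param_residual {κ s : ℂ} (hκ : κ ^ 2 = 8) (hs : s ^ 2 = -2) :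
    param κ (κ * s / 4) = (-1 : ℂ) • ![-2 * s, 2 * s, 1] := by
  have h1 : (κ * s / 4) ^ 2 = -1 := by linear_combination s ^ 2 / 16 * hκ + hs / 2
  have h2 : κ * (κ * s / 4) = 2 * s := by linear_combination s / 4 * hκ
  simp only [param, h1, h2]
  ext i
  fin_cases i <;> simp

theorem IsConfiguration.exists_mapsCurve {F : Form} {p : Fin 7 → Plane}
    (h : IsConfiguration F p) :
    ∃ (T : (Fin 3 → ℂ) ≃ₗ[ℂ] (Fin 3 → ℂ)) (r : ℂ), r ^ 2 = -2 ∧ MapsCurve T F stdQuartic ∧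
      ∀ i, T • p i = stdPoints r i := by
  have hF := h.quartic.2
  obtain ⟨S, C, κ, hC, hκ, hk, hS, ⟨h2, hp2⟩, ⟨h1, hp1⟩, ⟨h0, hp0⟩⟩ := h.exists_frame
  have hparam : ∀ i : Fin 7, OnCurve F (p i) → i ≠ 0 → i ≠ 1 → i ≠ 2 →
      ∃ m, m ≠ 0 ∧ κ * m - m ^ 2 - 1 ≠ 0 ∧
        ∃ h0, p i = Projectivization.mk ℂ (S (param κ m)) h0 := by
    intro i hi hi0 hi1 hi2
    refine exists_eq_mk_param hF hC hS hi (fun _ => ?_) (fun _ => ?_) (fun _ => ?_)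
    · rw [← hp2]; exact h.distinct.ne hi2
    · rw [← hp1]; exact h.distinct.ne hi1
    · rw [← hp0]; exact h.distinct.ne hi0
  obtain ⟨m₁, hm₁, hW₁, h3, hp3⟩ := hparam 3 h.flex₄.1.1 (by decide) (by decide) (by decide)
  obtain ⟨m₂, hm₂, hW₂, h4, hp4⟩ := hparam 4 h.flex₅.1.1 (by decide) (by decide) (by decide)
  obtain ⟨n₁, hn₁, hV₁, h5, hp5⟩ := hparam 5 h.mem₆ (by decide) (by decide) (by decide)
  obtain ⟨n₂, hn₂, hV₂, h6, hp6⟩ := hparam 6 h.mem₇ (by decide) (by decide) (by decide)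
  have hf₁ := h.flex₄
  have hf₂ := h.flex₅
  rw [hp3, isFlex_mk_iff hF] at hf₁
  rw [hp4, isFlex_mk_iff hF] at hf₂
  have hq₁ := hf₁.quadratic hC hκ hS hm₁ hW₁
  have hq₂ := hf₂.quadratic hC hκ hS hm₂ hW₂
  have ht₁ := h.tangent₄
  have ht₂ := h.tangent₅
  rw [hp3, hp5, onTangentLine_mk_iff hF, (coeff_along_normalForm hS _ _).1, mul_eq_zero] at ht₁
  rw [hp4, hp6, onTangentLine_mk_iff hF, (coeff_along_normalForm hS _ _).1, mul_eq_zero] at ht₂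
  have hne₁ : n₁ ≠ m₁ := by
    rintro rfl
    exact h.distinct.ne (show (3 : Fin 7) ≠ 5 by decide) (by rw [hp3, hp5])
  have hne₂ : n₂ ≠ m₂ := by
    rintro rfl
    exact h.distinct.ne (show (4 : Fin 7) ≠ 6 by decide) (by rw [hp4, hp6])
  have hne : m₁ ≠ m₂ := by
    rintro rfl
    exact h.distinct.ne (show (3 : Fin 7) ≠ 4 by decide) (by rw [hp3, hp4])
  have hr₁ := residual_param hκ hk hm₁ hW₁ hq₁ hne₁ (ht₁.resolve_left hC)
  have hr₂ := residual_param hκ hk hm₂ hW₂ hq₂ hne₂ (ht₂.resolve_left hC)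
  have hcol := h.collinear
  rw [hp0, hp5, hp6, dependent_mk_iff] at hcol
  have hsq := sq_eq_sq_of_not_linearIndependent hV₁ hV₂
    (fun H => hcol (linearIndependent_triple_map S H))
  rw [hr₁, hr₂] at hsq
  obtain ⟨r, hr, hκ8, hmr₁, hmr₂⟩ := flex_parameters hq₁ hq₂ hne hsq
  have hnr₁ : n₁ = κ * r / 4 := by rw [hr₁, hmr₁]; ring
  have hnr₂ : n₂ = κ * (-r) / 4 := by rw [hr₂, hmr₂]; ring
  -- The points of index 4 and 6 are those of index 3 and 5 with −r in place of r.
  have hcoord : ∀ i, ∃ (a : ℂ) (u : Fin 3 → ℂ) (hu : S u ≠ 0),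
      p i = Projectivization.mk ℂ (S u) hu ∧ a • stdCoords r i = shear u := by
    intro i
    fin_cases i
    · exact ⟨1, _, h0, hp0, by simp [stdCoords, shear]⟩
    · exact ⟨1, _, h1, hp1, by simp [stdCoords, shear]⟩
    · exact ⟨1, _, h2, hp2, by simp [stdCoords, shear]⟩
    · refine ⟨(7 - 4 * r) / 81, _, h3, hp3, ?_⟩
      rw [hmr₁, param_flex hκ8 hr, map_smul]
      congr 1
      ext i; fin_cases i <;> simp [stdCoords, shear]; ring
    · refine ⟨(7 - 4 * (-r)) / 81, _, h4, hp4, ?_⟩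
      rw [hmr₂, ← sub_neg_eq_add 4 r, param_flex hκ8 (by simpa using hr : (-r) ^ 2 = -2), map_smul]
      congr 1
      ext i; fin_cases i <;> simp [stdCoords, shear] <;> ring
    · refine ⟨-1, _, h5, hp5, ?_⟩
      rw [hnr₁, param_residual hκ8 hr, map_smul]
      congr 1
      ext i; fin_cases i <;> simp [stdCoords, shear]
    · refine ⟨-1, _, h6, hp6, ?_⟩
      rw [hnr₂, param_residual hκ8 (by simpa using hr : (-r) ^ 2 = -2), map_smul]
      congr 1
      ext i; fin_cases i <;> simp [stdCoords, shear]
  refine ⟨S.symm.trans shear, r, hr, ⟨C⁻¹, inv_ne_zero hC, ?_⟩, fun i => ?_⟩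
  · refine MvPolynomial.funext fun v => ?_
    obtain ⟨u, rfl⟩ := S.surjective v
    rw [eval_bind₁_toMvPolynomial, eval_stdQuartic, MvPolynomial.smul_eval, hS, hκ8,
      inv_mul_cancel_left₀ hC]
    simp [shear, show u 2 + u 0 + u 1 - u 0 - u 1 = u 2 by ring]
  · obtain ⟨a, u, hu, hpu, ha⟩ := hcoord i
    rw [hpu, Projectivization.smul_mk, stdPoints]
    refine mk_eq_mk_of_smul _ _ a ?_
    rw [ha]
    simp [LinearEquiv.smul_def]

theorem MapsCurve.projectivelyEquivalent {F G H : Form} {T U : (Fin 3 → ℂ) ≃ₗ[ℂ] (Fin 3 → ℂ)}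
    (hF : MapsCurve T F H) (hG : MapsCurve U G H) : ProjectivelyEquivalent F G := by
  obtain ⟨c, hc, hcF⟩ := hF
  obtain ⟨d, hd, hdG⟩ := hG
  refine ⟨T.trans U.symm, c / d, div_ne_zero hc hd, MvPolynomial.funext fun v => ?_⟩
  have h1 := congrArg (MvPolynomial.eval v) hcF
  have h2 := congrArg (MvPolynomial.eval (U.symm (T v))) hdG
  rw [eval_bind₁_toMvPolynomial, MvPolynomial.smul_eval] at h1 h2
  rw [U.apply_symm_apply] at h2
  rw [eval_bind₁_toMvPolynomial, MvPolynomial.smul_eval, LinearEquiv.trans_apply]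
  field_simp
  rw [mul_comm, ← h2, h1]

/-! ### Converse: the standard curve and points form a configuration -/

theorem eval_shear_stdQuartic (u : Fin 3 → ℂ) :
    MvPolynomial.eval (shear u) stdQuartic = 1 * normalForm 8 (u 0) (u 1) (u 2) := by
  rw [eval_stdQuartic]
  simp [shear, show u 2 + u 0 + u 1 - u 0 - u 1 = u 2 by ring]

theorem isHomogeneous_stdQuartic : stdQuartic.IsHomogeneous 4 := by
  have hX := fun i : Fin 3 => MvPolynomial.isHomogeneous_X ℂ i
  have h2 : (MvPolynomial.X 0 ^ 2 + MvPolynomial.X 0 * MvPolynomial.X 1 + MvPolynomial.X 1 ^ 2 -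
      MvPolynomial.X 0 * MvPolynomial.X 2 - MvPolynomial.X 1 * MvPolynomial.X 2 :
        Form).IsHomogeneous 2 :=
    (((((hX 0).pow 2).add ((hX 0).mul (hX 1))).add ((hX 1).pow 2)).sub ((hX 0).mul (hX 2))).sub
      ((hX 1).mul (hX 2))
  have h1 : (MvPolynomial.X 0 + MvPolynomial.X 1 - MvPolynomial.X 2 : Form).IsHomogeneous 1 :=
    ((hX 0).add (hX 1)).sub (hX 2)
  have h8 : (8 : Form).IsHomogeneous 0 := MvPolynomial.isHomogeneous_C (Fin 3) (8 : ℂ)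
  exact (h2.pow 2).sub (((h8.mul (hX 0)).mul (hX 1)).mul (h1.pow 2))

theorem stdQuartic_ne_zero : stdQuartic ≠ 0 := by
  intro h
  have := eval_shear_stdQuartic ![1, 1, 0]
  rw [h] at this
  simp [normalForm] at this

theorem singularAt_stdQuartic {u : Fin 3 → ℂ} (h : normalForm 8 (u 0) (u 1) (u 2) = 0)
    (h' : ∀ w, polarForm 8 u w = 0) : SingularAt stdQuartic (shear u) := by
  refine ⟨by rw [eval_shear_stdQuartic, h, mul_zero], fun w => ?_⟩
  obtain ⟨w, rfl⟩ := shear.surjective w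
  rw [(coeff_along_normalForm eval_shear_stdQuartic _ _).1, h', mul_zero]

theorem nodeAt_stdQuartic : NodeAt stdQuartic (shear ![0, 0, 1]) := by
  refine ⟨singularAt_stdQuartic (by simp [normalForm]) (fun w => by simp [polarForm]), ?_⟩
  obtain ⟨s, hs⟩ := IsAlgClosed.exists_pow_nat_eq (2 : ℂ) (n := 2) (by norm_num)
  have hs0 : s ≠ 0 := by
    rintro rfl
    norm_num at hs
  let l (c : ℂ) : Module.Dual ℂ (Fin 3 → ℂ) :=
    (LinearMap.proj 0 - c • LinearMap.proj 1) ∘ₗ shear.symm.toLinearMap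
  have hl : ∀ c u, l c (shear u) = u 0 - c * u 1 := fun c u => by simp [l]
  -- The tangent cone is x² − 6xy + y², with roots x/y = 3 ± 2√2.
  refine ⟨l (3 + 2 * s), l (3 - 2 * s), ?_, fun w => ?_⟩
  · rw [LinearIndependent.pair_iff]
    intro a b hab
    have h0 := LinearMap.congr_fun hab (shear ![1, 0, 0])
    have h1 := LinearMap.congr_fun hab (shear ![0, 1, 0])
    simp [hl] at h0 h1
    have ha : a * s = 0 := by linear_combination (-1 / 4) * h1 - (3 - 2 * s) / 4 * h0
    have ha0 : a = 0 := by simpa [hs0] using ha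
    exact ⟨ha0, by simpa [ha0] using h0⟩
  · obtain ⟨w, rfl⟩ := shear.surjective w
    rw [(coeff_along_normalForm eval_shear_stdQuartic _ _).2.1, hl, hl]
    simp [hessForm]
    linear_combination 4 * w 1 ^ 2 * hs

/-- The index i treats both cusps at once. On the tangent the cubic part −8wᵢ³ can vanish only in
the direction of the cusp itself. -/
theorem cuspAt_stdQuartic {u : Fin 3 → ℂ} {i : Fin 3} (hi : i ≠ 2)
    (hsing : SingularAt stdQuartic (shear u))
    (h₂ : ∀ w, hessForm 8 u w = (w i + w 2) ^ 2)
    (h₃ : ∀ w, w i + w 2 = 0 → cubicForm 8 u w = -8 * w i ^ 3)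
    (hu : ∀ w : Fin 3 → ℂ, w i = 0 → w 2 = 0 → ∃ a : ℂ, w = a • u) :
    CuspAt stdQuartic (shear u) := by
  let l : Module.Dual ℂ (Fin 3 → ℂ) :=
    (LinearMap.proj (R := ℂ) (φ := fun _ => ℂ) i + LinearMap.proj 2) ∘ₗ shear.symm.toLinearMap
  have hl : ∀ u, l (shear u) = u i + u 2 := fun u => by simp [l]
  refine ⟨hsing, l, fun h0 => ?_, fun w => ?_, fun w hli hw => ?_⟩
  · have := hl (Pi.single 2 1)
    rw [h0] at this
    simp [hi] at this
  · obtain ⟨w, rfl⟩ := shear.surjective w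
    rw [(coeff_along_normalForm eval_shear_stdQuartic _ _).2.1, hl, h₂, one_mul]
  · obtain ⟨w, rfl⟩ := shear.surjective w
    rw [hl] at hw
    rw [(coeff_along_normalForm eval_shear_stdQuartic _ _).2.2, h₃ w hw]
    intro h
    have hwi : w i = 0 := by simpa using h
    rw [hwi, zero_add] at hw
    obtain ⟨a, ha⟩ := hu w hwi hw
    have := LinearIndependent.pair_iff.1 hli a (-1) (by rw [ha, map_smul]; module)
    simp at this

theorem polarForm_flex {s : ℂ} (hs : s ^ 2 = -2) (w : Fin 3 → ℂ) :
    polarForm 8 ![8 + 2 * s, 8 - 2 * s, 9] w =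
      432 * ((5 + s) * w 0 + (5 - s) * w 1 - 8 * w 2) := by
  simp [polarForm]
  linear_combination
    (-8 * ((17 - 2 * s) * w 0 + (17 + 2 * s) * w 1 + 16 * w 2) + 576 * w 2) * hs

theorem flexAt_stdQuartic {s : ℂ} (hs : s ^ 2 = -2) :
    FlexAt stdQuartic (shear ![8 + 2 * s, 8 - 2 * s, 9]) := by
  -- The second-order part is divisible by the tangent's linear form from `polarForm_flex`, which is
  -- the flex condition.
  have hQ : ∀ w, hessForm 8 ![8 + 2 * s, 8 - 2 * s, 9] w =
      ((5 + s) * w 0 + (5 - s) * w 1 - 8 * w 2) *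
        ((47 - 23 * s) * w 0 + (47 + 23 * s) * w 1 + 40 * w 2) := by
    intro w
    simp [hessForm]
    linear_combination (27 * w 0 ^ 2 + 27 * w 1 ^ 2 - 62 * w 0 * w 1 - 8 * w 0 * w 2 -
      8 * w 1 * w 2 + 32 * w 2 ^ 2) * hs
  refine ⟨⟨?_, shear ![0, 0, 1], ?_⟩, fun w _ h => ?_⟩
  · rw [eval_shear_stdQuartic]
    simp [normalForm]
    linear_combination (864 + 16 * (s ^ 2 + 2)) * hs
  · rw [(coeff_along_normalForm eval_shear_stdQuartic _ _).1, polarForm_flex hs]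
    simp
  · obtain ⟨w, rfl⟩ := shear.surjective w
    have hc := coeff_along_normalForm eval_shear_stdQuartic ![8 + 2 * s, 8 - 2 * s, 9] w
    rw [hc.1, polarForm_flex hs] at h
    rw [hc.2.1, hQ]
    have : (5 + s) * w 0 + (5 - s) * w 1 - 8 * w 2 = 0 := by simpa using h
    rw [this]
    simp

/-- Such an r is purely imaginary and nonzero, so real and imaginary parts separate the
coefficients. -/
theorem intCast_add_mul_injective {r : ℂ} (hr : r ^ 2 = -2) {a b c d : ℤ}
    (h : (a : ℂ) + b * r = c + d * r) : a = c ∧ b = d := by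
  have hre := congrArg Complex.re hr
  have him := congrArg Complex.im hr
  simp [pow_two] at hre him
  have hre0 : r.re = 0 := by
    rcases mul_eq_zero.1 (show r.re * r.im = 0 by linarith) with h | h
    · exact h
    · rw [h] at hre
      nlinarith [sq_nonneg r.re]
  have him0 : r.im ≠ 0 := by
    intro h0
    rw [hre0, h0] at hre
    norm_num at hre
  have h1 := congrArg Complex.re h
  have h2 := congrArg Complex.im h
  simp [hre0] at h1 h2
  exact ⟨h1, h2.resolve_right him0⟩

theorem stdPoints_injective {r : ℂ} (hr : r ^ 2 = -2) : Function.Injective (stdPoints r) := by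
  -- The invariant 25(x − y)/z of each point equals α + βr, and the seven pairs (α, β) are distinct.
  let α : Fin 7 → ℤ := ![0, -25, 25, 0, 0, 0, 0]
  let β : Fin 7 → ℤ := ![0, 0, 0, 4, -4, -100, 100]
  have hαβ : ∀ i j, α i = α j → β i = β j → i = j := by decide
  have hslope : ∀ i, 25 * (stdCoords r i 0 - stdCoords r i 1) =
      (α i + β i * r) * stdCoords r i 2 := by
    intro i
    fin_cases i <;> simp [stdCoords, α, β] <;> ring
  have h2 : ∀ i, stdCoords r i 2 ≠ 0 := by
    intro i
    fin_cases i <;> simp [stdCoords]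
  intro i j hij
  obtain ⟨a, ha⟩ := (Projectivization.mk_eq_mk_iff' ℂ _ _ _ _).1 hij
  have ha' : ∀ n, a * stdCoords r j n = stdCoords r i n := fun n => congrFun ha n
  have key : ((α i + β i * r) - (α j + β j * r)) * stdCoords r i 2 = 0 := by
    linear_combination -hslope i + a * hslope j - 25 * (ha' 0 - ha' 1) + (α j + β j * r) * ha' 2
  have := intCast_add_mul_injective hr (sub_eq_zero.1 ((mul_eq_zero.1 key).resolve_right (h2 i)))
  exact hαβ i j this.1 this.2

theorem stdPoints_eq_mk_shear (r : ℂ) (i : Fin 7) {u : Fin 3 → ℂ} (h : stdCoords r i = shear u) :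
    ∃ h0, stdPoints r i = Projectivization.mk ℂ (shear u) h0 :=
  ⟨h ▸ stdCoords_ne_zero r i, by simp only [stdPoints, h]⟩

theorem isConfiguration_stdQuartic {r : ℂ} (hr : r ^ 2 = -2) :
    IsConfiguration stdQuartic (stdPoints r) := by
  have hF := isHomogeneous_stdQuartic
  have hr' : (-r) ^ 2 = -2 := by simpa using hr
  obtain ⟨h0, hp0⟩ := stdPoints_eq_mk_shear r 0 (u := ![0, 0, 1]) (by simp [stdCoords, shear])
  obtain ⟨h1, hp1⟩ := stdPoints_eq_mk_shear r 1 (u := ![0, 1, 0]) (by simp [stdCoords, shear])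
  obtain ⟨h2, hp2⟩ := stdPoints_eq_mk_shear r 2 (u := ![1, 0, 0]) (by simp [stdCoords, shear])
  obtain ⟨h3, hp3⟩ := stdPoints_eq_mk_shear r 3 (u := ![8 + 2 * r, 8 - 2 * r, 9])
    (by simp [stdCoords, shear]; ring)
  obtain ⟨h4, hp4⟩ := stdPoints_eq_mk_shear r 4 (u := ![8 + 2 * -r, 8 - 2 * -r, 9])
    (by ext i; fin_cases i <;> simp [stdCoords, shear] <;> ring)
  obtain ⟨h5, hp5⟩ := stdPoints_eq_mk_shear r 5 (u := ![-2 * r, 2 * r, 1])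
    (by simp [stdCoords, shear])
  obtain ⟨h6, hp6⟩ := stdPoints_eq_mk_shear r 6 (u := ![-2 * -r, 2 * -r, 1])
    (by simp [stdCoords, shear])
  have hmem : ∀ s : ℂ, s ^ 2 = -2 →
      MvPolynomial.eval (shear ![-2 * s, 2 * s, 1]) stdQuartic = 0 := fun s hs => by
    rw [eval_shear_stdQuartic]
    simp [normalForm]
    linear_combination 16 * s ^ 2 * hs
  have htan : ∀ s : ℂ, s ^ 2 = -2 →
      (along stdQuartic (shear ![8 + 2 * s, 8 - 2 * s, 9]) (shear ![-2 * s, 2 * s, 1])).coeff 1 =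
        0 := fun s hs => by
    rw [(coeff_along_normalForm eval_shear_stdQuartic _ _).1, polarForm_flex hs]
    simp
    linear_combination (-4) * hs
  refine ⟨⟨stdQuartic_ne_zero, hF⟩, stdPoints_injective hr, ?_, ?_, ?_, ?_, ?_, ?_, ?_, ?_, ?_, ?_⟩
  · rw [hp0, isNode_mk_iff hF]
    exact nodeAt_stdQuartic
  · rw [hp1, isOrdinaryCusp_mk_iff hF]
    refine cuspAt_stdQuartic (i := 0) (by decide) (singularAt_stdQuartic (by simp [normalForm])
      (fun w => by simp [polarForm])) (fun w => by simp [hessForm]) (fun w hw => ?_)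
      (fun w hw0 hw2 => ⟨w 1, by ext i; fin_cases i <;> simp [hw0, hw2]⟩)
    simp [cubicForm]
    linear_combination (2 * (w 0 * w 1 + w 0 * w 2 + w 1 * w 2) - 8 * w 0 * (w 2 - w 0)) * hw
  · rw [hp2, isOrdinaryCusp_mk_iff hF]
    refine cuspAt_stdQuartic (i := 1) (by decide) (singularAt_stdQuartic (by simp [normalForm])
      (fun w => by simp [polarForm])) (fun w => by simp [hessForm]) (fun w hw => ?_)
      (fun w hw0 hw2 => ⟨w 0, by ext i; fin_cases i <;> simp [hw0, hw2]⟩)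
    simp [cubicForm]
    linear_combination (2 * (w 0 * w 1 + w 0 * w 2 + w 1 * w 2) - 8 * w 1 * (w 2 - w 1)) * hw
  · rw [hp3, isFlex_mk_iff hF]
    exact flexAt_stdQuartic hr
  · rw [hp4, isFlex_mk_iff hF]
    exact flexAt_stdQuartic hr'
  · rw [hp5, onCurve_mk_iff hF]
    exact hmem r hr
  · rw [hp6, onCurve_mk_iff hF]
    exact hmem (-r) hr'
  · rw [hp3, hp5, onTangentLine_mk_iff hF]
    exact htan r hr
  · rw [hp4, hp6, onTangentLine_mk_iff hF]
    exact htan (-r) hr'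
  · rw [hp0, hp5, hp6, dependent_mk_iff, Fintype.linearIndependent_iff]
    intro H
    -- The vectors of p₆ and p₇ sum to twice that of p₁.
    have := H ![2, -1, -1] (by
      rw [Fin.sum_univ_three]
      ext i
      fin_cases i <;> simp [shear]
      norm_num) 0
    simp at this

end PlaneQuartic

end

theorem mainTheorem3 :
    (∃ (F : PlaneQuartic.Form) (p : Fin 7 → PlaneQuartic.Plane),
      PlaneQuartic.IsConfiguration F p) ∧
    (∀ (F G : PlaneQuartic.Form) (p q : Fin 7 → PlaneQuartic.Plane),
      PlaneQuartic.IsConfiguration F p → PlaneQuartic.IsConfiguration G q →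
        PlaneQuartic.ProjectivelyEquivalent F G) ∧
    (∀ r : ℂ, r ^ 2 = -2 →
      PlaneQuartic.IsConfiguration PlaneQuartic.stdQuartic (PlaneQuartic.stdPoints r)) ∧
    (∀ (F : PlaneQuartic.Form) (p : Fin 7 → PlaneQuartic.Plane),
      PlaneQuartic.IsConfiguration F p →
        ∃ (T : (Fin 3 → ℂ) ≃ₗ[ℂ] (Fin 3 → ℂ)) (r : ℂ), r ^ 2 = -2 ∧
          PlaneQuartic.MapsCurve T F PlaneQuartic.stdQuartic ∧
          ∀ i, T • p i = PlaneQuartic.stdPoints r i) := by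
  refine ⟨?_, fun F G p q hF hG => ?_, fun r hr => PlaneQuartic.isConfiguration_stdQuartic hr,
    fun F p h => h.exists_mapsCurve⟩
  · obtain ⟨r, hr⟩ := IsAlgClosed.exists_pow_nat_eq (-2 : ℂ) (n := 2) (by norm_num)
    exact ⟨_, _, PlaneQuartic.isConfiguration_stdQuartic hr⟩
  · obtain ⟨T, -, -, hT, -⟩ := hF.exists_mapsCurve
    obtain ⟨U, -, -, hU, -⟩ := hG.exists_mapsCurve
    exact hT.projectivelyEquivalent hU
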